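/- For integers $n,N,\ell>1$, a secret $\mathbf s\in\mathbb Z_N^n$ and a weight function $f:\mathbb Z\to\mathbb C$ that is nonzero and square-summable, an instance of $\mathrm{EDCP}_{n,N,f}^{\ell}$ with secret $\mathbf s$ consists of the $\ell$ quantum states $$\Big(\sum_{j\in\mathbb Z}|f(j)|^2\Big)^{-1/2}\sum_{j\in\mathbb Z} f(j)\,|j\rangle\,|(\mathbf x_k+j\,\mathbf s)\bmod N\rangle ,\qquad 1\le k\le \ell,$$ with arbitrary $\mathbf x_1,\dots,\mathbf x_\ell\in\mathbb Z_N^n$; the task is to output $\mathbf s$. An algorithm finds $\mathbf s$ with probability at least $p$ if it does so for every choice of $\mathbf x_1,\dots,\mathbf x_\ell$. In $\mathrm{G\text{-}EDCP}_{n,N,r}^{\ell}$ ($r>0$) the weights are $f(j)=\rho_r(j)=\exp(-\pi j^2/r^2)$; in $\mathrm{U\text{-}EDCP}_{n,N,M}^{\ell}$ ($M\ge 1$ an integer) $f$ is the indicator function of $\{0,1,\dots,M-1\}$ (and here $\ell=0$ and $\ell=1$ are allowed too). **Lemma (G-EDCP $\le$ U-EDCP).** Let $c>0$ be a constant. There is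 one (uniform) quantum program, with classical control and measurements, and a polynomial $T$, such that the following holds for the security parameter $\kappa$ and all integers $n,N,\ell>1$, $\ell'\ge 0$ and real $r>0$ for which $M=c\cdot r$ is an integer. The program takes $\kappa,n,N,\ell,\ell',M,r$ and an instance of $\mathrm{G\text{-}EDCP}_{n,N,r}^{\ell}$; gates act on at most three qubits, and exact computation with real numbers is allowed for the parameters of rotations. 1. Run-time: in every branch the program makes at most $T(\kappa+n+\lceil\log_2 N\rceil+\ell+\lceil\log_2 M\rceil)$ steps. So its run-time is polynomial in $\kappa$ when $n$, $\ell$, $\log N$ and $\log M$ are polynomially bounded in $\kappa$. 2. Correctness: for every $A>0$ there are $\delta>0$ and $\kappa_0$, depending only on $c$ and $A$, such that whenever $\kappa\ge\kappa_0$ and $\ell'\le A\,\ell/\kappa$ (that is, $\ell'=O(\ell/\kappa)$), the following holds. Let $\mathcal O$ be any quantum procedure (any generalised measurement on the qubits of an instance) that finds the secret $\mathbf s$ with probability at least $p$ from instances of $\mathrm{U\text{-}EDCP}_{n,N,M}^{\ell'}$ with secret $\mathbf s$. Then the program, followed by one call of $\mathcal O$ on designated qubits of its memory, whose answer is the output,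 finds $\mathbf s$ with probability at least $p\,(1-2^{-\delta\kappa})$ from instances of $\mathrm{G\text{-}EDCP}_{n,N,r}^{\ell}$ with secret $\mathbf s$. -/

import Mathlib

open scoped ENNReal

noncomputable section

namespace EDCP

/-! ### Quantum memory

The quantum memory is a countable family of two-dimensional arrays of qubits; the qubit `(a, k, i)`
is the one in array `a`, row `k`, column `i`. A computational basis state is described by the finite
set of the qubits that are `1`, and a (possibly subnormalised) pure state by its amplitudes. -/

abbrev Qubit : Type := ℕ × ℕ × ℕ

abbrev Memory : Type := Finset Qubit → ℂ

/-- Positions of the ones in the binary expansion of `a`. -/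
def bits (a : ℕ) : Finset ℕ := (Finset.range a.size).filter fun i => a.testBit i = true

theorem mem_bits {a i : ℕ} : i ∈ bits a ↔ a.testBit i = true := by
  simp only [bits, Finset.mem_filter, Finset.mem_range, and_iff_right_iff_imp]
  intro h
  by_contra hh
  rw [Nat.testBit_lt_two_pow (lt_of_lt_of_le (Nat.lt_size_self a) (Nat.pow_le_pow_right (by norm_num) (not_lt.1 hh)))] at h
  simp at h

/-- The basis state that holds, for every `k`, the pair `(j k, y k) ∈ ℤ × ℤ_N^n` in row `k`:
the sign of `j k` in array `0` (a one meaning negative), `|j k|` in binary in array `1`, and the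
`a`-th coordinate of `y k` in binary in array `2 + a`. All other qubits are zero. -/
def encode {n N ℓ : ℕ} (j : Fin ℓ → ℤ) (y : Fin ℓ → Fin n → ZMod N) : Finset Qubit :=
  Finset.univ.biUnion fun k : Fin ℓ =>
    (if j k < 0 then {(0, (k : ℕ), 0)} else ∅) ∪
    (bits (j k).natAbs).image (fun i => (1, (k : ℕ), i)) ∪
    Finset.univ.biUnion fun a : Fin n =>
      (bits (y k a).val).image fun i => (2 + (a : ℕ), (k : ℕ), i)

/-- The terms of the superposition `edcpState` below are distinct basis states. -/
theorem encode_injective {n N ℓ : ℕ} (s : Fin n → ZMod N) (x : Fin ℓ → Fin n → ZMod N) :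
    Function.Injective
      (fun j : Fin ℓ → ℤ => encode j fun k a => x k a + (j k : ZMod N) * s a) := by
  intro j j' h
  funext k
  have hs : ∀ j : Fin ℓ → ℤ, ∀ y : Fin ℓ → Fin n → ZMod N,
      ((0, (k : ℕ), 0) ∈ encode j y ↔ j k < 0) := by
    intro j y
    simp only [encode, Finset.mem_biUnion, Finset.mem_univ, true_and, Finset.mem_union,
      Finset.mem_image, Prod.mk.injEq]
    constructor
    · rintro ⟨k', (h | ⟨i, _, h, _⟩) | ⟨a, i, _, h, _⟩⟩
      · split_ifs at h with h'
        · simp only [Finset.mem_singleton, Prod.mk.injEq, true_and, and_true] at h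
          rwa [Fin.ext h]
        · simp at h
      · omega
      · omega
    · intro h
      exact ⟨k, Or.inl (Or.inl (by simp [h]))⟩
  have hm : ∀ j : Fin ℓ → ℤ, ∀ y : Fin ℓ → Fin n → ZMod N, ∀ i,
      ((1, (k : ℕ), i) ∈ encode j y ↔ (j k).natAbs.testBit i = true) := by
    intro j y i
    simp only [encode, Finset.mem_biUnion, Finset.mem_univ, true_and, Finset.mem_union,
      Finset.mem_image, Prod.mk.injEq, mem_bits]
    constructor
    · rintro ⟨k', (h | ⟨i', hi, h, rfl⟩) | ⟨a, i, _, h, _⟩⟩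
      · split_ifs at h <;> simp at h
      · rwa [← Fin.ext h]
      · omega
    · intro h
      exact ⟨k, Or.inl (Or.inr ⟨i, h, rfl, rfl⟩)⟩
  have h1 : (j k < 0 ↔ j' k < 0) := by rw [← hs j, ← hs j']; simp only at h; rw [h]
  have h2 : (j k).natAbs = (j' k).natAbs := by
    apply Nat.eq_of_testBit_eq
    intro i
    rw [Bool.eq_iff_iff, ← hm j, ← hm j']; simp only at h; rw [h]
  omega

/-! ### The extrapolated dihedral coset problem -/

/-- Normalised amplitude of `j` in the superposition with weights `f`. -/
def amplitude (f : ℤ → ℂ) (j : ℤ) : ℂ := f j / (Real.sqrt (∑' i : ℤ, ‖f i‖ ^ 2) : ℝ)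

/-- The memory that contains the `ℓ` normalised states `∑_j f(j) |j⟩ |x_k + j s mod N⟩` in its rows
`0, …, ℓ - 1`, and zeros elsewhere. -/
def edcpState {n N ℓ : ℕ} (f : ℤ → ℂ) (s : Fin n → ZMod N) (x : Fin ℓ → Fin n → ZMod N) : Memory :=
  Function.extend (fun j : Fin ℓ → ℤ => encode j fun k a => x k a + (j k : ZMod N) * s a)
    (fun j => ∏ k, amplitude f (j k)) 0

/-- Gaussian weights `ρ_r(j) = exp(-π j² / r²)`. -/
def gaussianWeight (r : ℝ) (j : ℤ) : ℂ := (Real.exp (-Real.pi * (j : ℝ) ^ 2 / r ^ 2) : ℝ)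

/-- Uniform weights on `{0, …, M - 1}`. -/
def uniformWeight (M : ℕ) (j : ℤ) : ℂ := if 0 ≤ j ∧ j < M then 1 else 0

/-! ### Solvers for the uniform problem -/

/-- Names of the qubits of an instance of the uniform problem with `ℓ` states: every state has
`⌈log₂ M⌉` qubits for `j` and `⌈log₂ N⌉` qubits for each coordinate of `x + j s`. -/
abbrev Wire (n N M ℓ : ℕ) : Type := Fin ℓ × (Fin (Nat.clog 2 M) ⊕ Fin n × Fin (Nat.clog 2 N))

/-- Location of these qubits in the memory, in accordance with `encode`. -/
def Wire.address {n N M ℓ : ℕ} : Wire n N M ℓ → Qubit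
  | (t, Sum.inl i) => (1, (t : ℕ), (i : ℕ))
  | (t, Sum.inr (a, b)) => (2 + (a : ℕ), (t : ℕ), (b : ℕ))

open scoped ComplexOrder in
/-- An arbitrary quantum procedure that takes an instance of the uniform problem and outputs a
candidate for the secret, or fails: a generalised measurement (POVM) on the qubits of the instance,
whose outcome `s` has the effect `effect s`; what is missing to `1` is the effect of a failure. -/
structure Solver (n N M ℓ : ℕ) where
  effect : (Fin n → ZMod N) → Matrix (Finset (Wire n N M ℓ)) (Finset (Wire n N M ℓ)) ℂ
  posSemidef : ∀ s, (effect s).PosSemidef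
  sum_le_one : ∀ S : Finset (Fin n → ZMod N), (1 - ∑ s ∈ S, effect s).PosSemidef

open scoped Matrix in
/-- The probability (times the squared norm of `ψ`) that the solver outputs `s` when it is applied
to the qubits at the locations `Wire.address` of a memory in state `ψ`. The sum is over the contents
`R` of the other qubits. -/
def Solver.prob {n N M ℓ : ℕ} (O : Solver n N M ℓ) (s : Fin n → ZMod N) (ψ : Memory) : ℝ≥0∞ :=
  ∑' R : {R : Finset Qubit // ∀ w : Wire n N M ℓ, w.address ∉ R},
    let φ : Finset (Wire n N M ℓ) → ℂ := fun v => ψ (R.1 ∪ v.image Wire.address)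
    ENNReal.ofReal (star φ ⬝ᵥ (O.effect s *ᵥ φ)).re

/-- The solver finds the secret `s` with probability at least `p` from `ℓ` states with uniform
amplitudes on `{0, …, M - 1}`, whatever the shifts `x_1, …, x_ℓ` are. -/
def Solver.FindsUniform {n N M ℓ : ℕ} (O : Solver n N M ℓ) (s : Fin n → ZMod N) (p : ℝ) : Prop :=
  ∀ x : Fin ℓ → Fin n → ZMod N,
    ENNReal.ofReal p ≤ O.prob s (edcpState (uniformWeight M) s x)

/-! ### Quantum programs

Imperative programs with classical control: finitely many classical variables with natural number
values, measurements, and gates on at most three qubits whose addresses are computed from the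
classical variables. Every operation counts one step. Since classical values are only produced by
addition, truncated subtraction, halving and bit length, their length grows by `O(1)` per step. -/

/-- Natural number expressions in the classical variables. -/
inductive NExpr
  | lit (a : ℕ)
  | var (x : ℕ)
  | add (e₁ e₂ : NExpr)
  | sub (e₁ e₂ : NExpr)
  | half (e : NExpr)
  | clog (e : NExpr)

def NExpr.eval (σ : ℕ → ℕ) : NExpr → ℕ
  | lit a => a
  | var x => σ x
  | add e₁ e₂ => e₁.eval σ + e₂.eval σ
  | sub e₁ e₂ => e₁.eval σ - e₂.eval σ
  | half e => e.eval σ / 2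
  | clog e => Nat.clog 2 (e.eval σ)

/-- Real expressions in the classical variables and a real input. They only serve as parameters of
rotations. -/
inductive RExpr
  | input
  | nat (e : NExpr)
  | pi
  | add (e₁ e₂ : RExpr)
  | sub (e₁ e₂ : RExpr)
  | mul (e₁ e₂ : RExpr)
  | div (e₁ e₂ : RExpr)
  | exp (e : RExpr)
  | sqrt (e : RExpr)

def RExpr.eval (r : ℝ) (σ : ℕ → ℕ) : RExpr → ℝ
  | input => r
  | nat e => (e.eval σ : ℝ)
  | pi => Real.pi
  | add e₁ e₂ => e₁.eval r σ + e₂.eval r σ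
  | sub e₁ e₂ => e₁.eval r σ - e₂.eval r σ
  | mul e₁ e₂ => e₁.eval r σ * e₂.eval r σ
  | div e₁ e₂ => e₁.eval r σ / e₂.eval r σ
  | exp e => Real.exp (e.eval r σ)
  | sqrt e => Real.sqrt (e.eval r σ)

/-- Address of a qubit: array, row and column. -/
structure QExpr where
  array : NExpr
  row : NExpr
  col : NExpr

def QExpr.eval (σ : ℕ → ℕ) (q : QExpr) : Qubit := (q.array.eval σ, q.row.eval σ, q.col.eval σ)

/-- Pauli `X` gate on `q`. -/
def flip (q : Qubit) (ψ : Memory) : Memory := fun b => ψ (symmDiff b {q})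

/-- Phase gate `diag(1, i)` on `q`. -/
def phase (q : Qubit) (ψ : Memory) : Memory := fun b => if q ∈ b then Complex.I * ψ b else ψ b

/-- Toffoli gate with controls `c₁`, `c₂` and target `q` (a CNOT gate if `c₁ = c₂`). If the target
is among the controls, nothing is done. -/
def toffoli (c₁ c₂ q : Qubit) (ψ : Memory) : Memory := fun b =>
  if q ≠ c₁ ∧ q ≠ c₂ ∧ c₁ ∈ b ∧ c₂ ∈ b then ψ (symmDiff b {q}) else ψ b

/-- The rotation `|0⟩ ↦ cos θ |0⟩ + sin θ |1⟩`, `|1⟩ ↦ - sin θ |0⟩ + cos θ |1⟩` of the target `q`,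
controlled by `c₁` and `c₂`. If the target is among the controls, nothing is done. -/
def rotate (c₁ c₂ q : Qubit) (θ : ℝ) (ψ : Memory) : Memory := fun b =>
  if q ≠ c₁ ∧ q ≠ c₂ ∧ c₁ ∈ b ∧ c₂ ∈ b then
    if q ∈ b then (Real.sin θ : ℂ) * ψ (b.erase q) + (Real.cos θ : ℂ) * ψ b
    else (Real.cos θ : ℂ) * ψ b - (Real.sin θ : ℂ) * ψ (insert q b)
  else ψ b

/-- Projection to the outcome `v` of a measurement of `q`. -/
def project (q : Qubit) (v : Bool) (ψ : Memory) : Memory := fun b =>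
  if decide (q ∈ b) = v then ψ b else 0

inductive Program
  | skip
  | assign (x : ℕ) (e : NExpr)
  | flip (q : QExpr)
  | phase (q : QExpr)
  | toffoli (c₁ c₂ q : QExpr)
  | rotate (c₁ c₂ q : QExpr) (a : RExpr)
  | measure (q : QExpr) (x : ℕ)
  | seq (P₁ P₂ : Program)
  | ite (e₁ e₂ : NExpr) (P₁ P₂ : Program)
  | loop (x : ℕ) (e : NExpr) (P : Program)

/-- One branch of a computation: the classical variables, the number of steps so far, and the state
of the quantum memory, scaled so that its squared norm is the probability of the branch. -/
structure Config where
  store : ℕ → ℕ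
  steps : ℕ
  mem : Memory

/-- One elementary step that changes the memory by `g`. -/
def Config.apply (C : Config) (g : Memory → Memory) : Config := ⟨C.store, C.steps + 1, g C.mem⟩

/-- One elementary step that assigns the value `v` to the variable `x`. -/
def Config.set (C : Config) (x v : ℕ) : Config :=
  ⟨Function.update C.store x v, C.steps + 1, C.mem⟩

/-- One elementary step without effect. -/
def Config.tick (C : Config) : Config := ⟨C.store, C.steps + 1, C.mem⟩

/-- All branches of the run of a program with real input `r`. `rotate c₁ c₂ q a` rotates by the
angle `arccos a`, `measure q x` measures `q` and stores the outcome in `x`, `ite e₁ e₂ P₁ P₂` is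
`if e₁ ≤ e₂ then P₁ else P₂`, and `loop x e P` runs `P` for `x = 0, 1, …, e - 1`, where `e` is
evaluated once at the beginning. -/
def Program.run (r : ℝ) : Program → Config → List Config
  | skip, C => [C.tick]
  | assign x e, C => [C.set x (e.eval C.store)]
  | flip q, C => [C.apply (EDCP.flip (q.eval C.store))]
  | phase q, C => [C.apply (EDCP.phase (q.eval C.store))]
  | toffoli c₁ c₂ q, C =>
      [C.apply (EDCP.toffoli (c₁.eval C.store) (c₂.eval C.store) (q.eval C.store))]
  | rotate c₁ c₂ q a, C =>
      [C.apply (EDCP.rotate (c₁.eval C.store) (c₂.eval C.store) (q.eval C.store)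
        (Real.arccos (a.eval r C.store)))]
  | measure q x, C =>
      [(C.apply (project (q.eval C.store) false)).set x 0,
       (C.apply (project (q.eval C.store) true)).set x 1]
  | seq P₁ P₂, C => (P₁.run r C).flatMap fun C' => P₂.run r C'
  | ite e₁ e₂ P₁ P₂, C =>
      if e₁.eval C.store ≤ e₂.eval C.store then P₁.run r C.tick else P₂.run r C.tick
  | loop x e P, C =>
      (List.range (e.eval C.store)).foldl
        (fun L i => L.flatMap fun C' => P.run r (C'.set x i)) [C.tick]

/-! ### Reductions from the Gaussian to the uniform problem -/

/-- The branches of the run of `P` on the parameters `κ, n, N, ℓ, ℓ', M` (in the variables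
`0, …, 5`), the real input `r`, and `ℓ` states of the Gaussian problem with parameter `r`. -/
def Program.branches (P : Program) (κ n N ℓ ℓ' M : ℕ) (r : ℝ) (s : Fin n → ZMod N)
    (x : Fin ℓ → Fin n → ZMod N) : List Config :=
  P.run r ⟨fun i => [κ, n, N, ℓ, ℓ', M].getD i 0, 0, edcpState (gaussianWeight r) s x⟩

/-- The program `P`, followed by one call of the solver `O` of the uniform problem with `ℓ'` states,
whose answer is the output, finds the secret `s` with probability at least `p` from `ℓ` states with
Gaussian amplitudes, whatever the shifts `x_1, …, x_ℓ` are. -/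
def Program.FindsGaussian (P : Program) (κ ℓ : ℕ) (r : ℝ) {n N M ℓ' : ℕ} (O : Solver n N M ℓ')
    (s : Fin n → ZMod N) (p : ℝ) : Prop :=
  ∀ x : Fin ℓ → Fin n → ZMod N,
    ENNReal.ofReal p ≤ ((P.branches κ n N ℓ ℓ' M r s x).map fun C => O.prob s C.mem).sum

end EDCP

end

open scoped ENNReal

noncomputable section

namespace EDCP

/-! ### Expected payoff of a program -/

/-! The reduction is rejection sampling, row by row. Put B = ⌈log₂ M⌉. In each Gaussian state the
sign qubit and a range of bits of |j| above position B are measured, and only zeros are accepted.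
For 0 ≤ j < 2^B the weight exp(-πj²/r²) must then be flattened, that is, multiplied by a constant
times exp(πj²/r²), with all factors at most 1. Writing j = ∑ t_a with t_a ∈ {0, 2^a} gives (2^B -
1)² - j² = ∑_{a,b} (2^a 2^b - t_a t_b), so the factor exp(-π((2^B - 1)² - j²)/r²) is a product over
pairs of bits (`prod_damp`). Each factor is the accepting branch of a weak measurement made of a
controlled rotation of an auxiliary qubit (`damp`). A reversible comparison with M - 1 finally cuts
the range to {0, …, M - 1}.

On the qubits that the solver reads, the accepted amplitudes are exactly `successFactor` times the
uniform ones (`rowFactor_mul_rowAmp`). The square q of this factor is bounded below in terms of c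
only, because 2^B ≤ 2M = 2cr and the squared Gaussian norm is O(1 + r) (`successBound_mul_le`). The
only defect is that j ≥ 2^(2B+κ+ℓ) may be accepted as well; such j have total weight t = O(2^(-κ-ℓ))
(`gaussian_tail_le`).

Every branch of the measurement of a row multiplies the amplitudes by a real function of the content
of that row, and the squares of these functions add up to 1 (`WeakTransformer`). So product states
stay product states, and the failing branches have weight at least 1 - q - t. The solver's
probability is a sum of nonnegative terms over the contents of the qubits it does not read. Keeping
only the terms in which the rows it uses have no stray ones leaves a scalar times a perfect uniform
instance (`Solver.le_prob_permute`). The solver succeeds for all shifts, so it is irrelevant which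
rows were accepted.

It remains to bound the probability of at least ℓ' successes in ℓ trials (`winProb`). The
exponential moment E[2^(-successes)] bounds the shortfall by 2^ℓ' (1 - q/2)^ℓ (`le_winProb`). Since
ℓ' ≤ Aℓ/κ, for large κ the factor 2^ℓ' costs at most half of the exponent, and ℓ ≥ κ/A when ℓ' ≥ 1,
so the error is exponentially small in κ (`exists_winProb_bound`). -/

/-- The sum of the payoff `Q` over all branches of the run of a program. -/
def Program.wp (r : ℝ) : Program → ((ℕ → ℕ) → Memory → ℝ≥0∞) → (ℕ → ℕ) → Memory → ℝ≥0∞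
  | skip, Q, σ, ψ => Q σ ψ
  | assign x e, Q, σ, ψ => Q (Function.update σ x (e.eval σ)) ψ
  | flip q, Q, σ, ψ => Q σ (EDCP.flip (q.eval σ) ψ)
  | phase q, Q, σ, ψ => Q σ (EDCP.phase (q.eval σ) ψ)
  | toffoli c₁ c₂ q, Q, σ, ψ => Q σ (EDCP.toffoli (c₁.eval σ) (c₂.eval σ) (q.eval σ) ψ)
  | rotate c₁ c₂ q a, Q, σ, ψ =>
      Q σ (EDCP.rotate (c₁.eval σ) (c₂.eval σ) (q.eval σ) (Real.arccos (a.eval r σ)) ψ)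
  | measure q x, Q, σ, ψ =>
      Q (Function.update σ x 0) (project (q.eval σ) false ψ) +
      Q (Function.update σ x 1) (project (q.eval σ) true ψ)
  | seq P₁ P₂, Q, σ, ψ => P₁.wp r (P₂.wp r Q) σ ψ
  | ite e₁ e₂ P₁ P₂, Q, σ, ψ =>
      if e₁.eval σ ≤ e₂.eval σ then P₁.wp r Q σ ψ else P₂.wp r Q σ ψ
  | loop x e P, Q, σ, ψ =>
      (List.range (e.eval σ)).foldr (fun i K σ ψ => P.wp r K (Function.update σ x i) ψ) Q σ ψ

theorem sum_map_flatMap {α β : Type*} (L : List α) (f : α → List β) (g : β → ℝ≥0∞) :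
    ((L.flatMap f).map g).sum = (L.map fun a => ((f a).map g).sum).sum := by
  induction L with
  | nil => simp
  | cons a L ih => simp [ih]

/-- Success probabilities are sums over branches, so they obey a recursion on the program; the list
of branches never has to be described. -/
theorem Program.sum_run (r : ℝ) (P : Program) :
    ∀ (Q : (ℕ → ℕ) → Memory → ℝ≥0∞) (C : Config),
      ((P.run r C).map fun C' => Q C'.store C'.mem).sum = P.wp r Q C.store C.mem := by
  induction P with
  | skip => intro Q C; simp [run, wp, Config.tick]
  | assign x e => intro Q C; simp [run, wp, Config.set]
  | flip q => intro Q C; simp [run, wp, Config.apply]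
  | phase q => intro Q C; simp [run, wp, Config.apply]
  | toffoli c₁ c₂ q => intro Q C; simp [run, wp, Config.apply]
  | rotate c₁ c₂ q a => intro Q C; simp [run, wp, Config.apply]
  | measure q x => intro Q C; simp [run, wp, Config.apply, Config.set]
  | seq P₁ P₂ ih₁ ih₂ =>
    intro Q C
    simp only [run, wp, sum_map_flatMap, ih₂]
    exact ih₁ _ C
  | ite e₁ e₂ P₁ P₂ ih₁ ih₂ =>
    intro Q C
    simp only [run, wp]
    split_ifs
    · exact ih₁ Q C.tick
    · exact ih₂ Q C.tick
  | loop x e P ih =>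
    intro Q C
    simp only [run, wp]
    have key : ∀ (l : List ℕ) (L : List Config),
        ((l.foldl (fun L i => L.flatMap fun C' => P.run r (C'.set x i)) L).map
          fun C' => Q C'.store C'.mem).sum =
        (L.map fun C' => l.foldr (fun i K σ ψ => P.wp r K (Function.update σ x i) ψ) Q
          C'.store C'.mem).sum := by
      intro l
      induction l with
      | nil => intro L; simp
      | cons i l ihl =>
        intro L
        simp only [List.foldl_cons, List.foldr_cons]
        rw [ihl, sum_map_flatMap]
        congr 1
        apply List.map_congr_left
        intro C' _
        rw [ih (List.foldr (fun i K σ ψ => P.wp r K (Function.update σ x i) ψ) Q l)]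
        rfl
    rw [key]
    simp [Config.tick]

/-- Steps of a loop from index `i` on, as a payoff transformer. -/
theorem Program.wp_loop_det (r : ℝ) (x : ℕ) (e : NExpr) (P : Program) (S : ℕ → ℕ → ℕ)
    (G : ℕ → Memory) (n : ℕ) (hn : e.eval (S 0) = n)
    (h : ∀ i < n, ∀ Q, P.wp r Q (Function.update (S i) x i) (G i) = Q (S (i + 1)) (G (i + 1)))
    (Q) : (loop x e P).wp r Q (S 0) (G 0) = Q (S n) (G n) := by
  have key : ∀ m i, i + m = n →
      (List.range' i m).foldr (fun i K σ ψ => P.wp r K (Function.update σ x i) ψ) Q (S i) (G i)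
        = Q (S n) (G n) := by
    intro m
    induction m with
    | zero => intro i hi; obtain rfl : i = n := by omega
              simp
    | succ m ih =>
      intro i hi
      rw [List.range'_succ, List.foldr_cons, h i (by omega)]
      exact ih (i + 1) (by omega)
  simp only [wp, hn, List.range_eq_range']
  exact key n 0 (by omega)

/-! ### Running time -/

/-- The value of an expression is determined by the variables below `6`. -/
def NExpr.Static : NExpr → Prop
  | lit _ => True
  | var x => x < 6
  | add e₁ e₂ => e₁.Static ∧ e₂.Static
  | sub e₁ e₂ => e₁.Static ∧ e₂.Static
  | half e => e.Static
  | clog e => e.Static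

theorem NExpr.Static.eval_congr {e : NExpr} (he : e.Static) {σ σ' : ℕ → ℕ}
    (h : ∀ i < 6, σ i = σ' i) : e.eval σ = e.eval σ' := by
  induction e with
  | lit a => rfl
  | var x => exact h x he
  | add e₁ e₂ ih₁ ih₂ => simp [eval, ih₁ he.1, ih₂ he.2]
  | sub e₁ e₂ ih₁ ih₂ => simp [eval, ih₁ he.1, ih₂ he.2]
  | half e ih => simp [eval, ih he]
  | clog e ih => simp [eval, ih he]

/-- The variables below `6` are never changed, and every loop has at most `B` iterations when these
variables have the values in `σ`. -/
def Program.Bounded (σ : ℕ → ℕ) (B : ℕ) : Program → Prop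
  | assign x _ => 6 ≤ x
  | measure _ x => 6 ≤ x
  | seq P₁ P₂ => P₁.Bounded σ B ∧ P₂.Bounded σ B
  | ite _ _ P₁ P₂ => P₁.Bounded σ B ∧ P₂.Bounded σ B
  | loop x e P => 6 ≤ x ∧ e.Static ∧ e.eval σ ≤ B ∧ P.Bounded σ B
  | _ => True

open Polynomial in
/-- The number of steps in terms of a bound for the number of iterations of each loop. -/
def Program.cost : Program → Polynomial ℕ
  | measure _ _ => 2
  | seq P₁ P₂ => P₁.cost + P₂.cost
  | ite _ _ P₁ P₂ => 1 + P₁.cost + P₂.cost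
  | loop _ _ P => 1 + X * (1 + P.cost)
  | _ => 1

/-- Loop lengths are functions of the parameters alone and no instruction overwrites a parameter, so
each level of nesting costs a factor of at most `B`. The cost charges both sides of a conditional.
-/
theorem Program.Bounded.steps_le {σ : ℕ → ℕ} {B : ℕ} (r : ℝ) {P : Program} (hP : P.Bounded σ B) :
    ∀ (C : Config), (∀ i < 6, C.store i = σ i) → ∀ C' ∈ P.run r C,
      (∀ i < 6, C'.store i = σ i) ∧ C'.steps ≤ C.steps + P.cost.eval B := by
  have upd : ∀ (τ : ℕ → ℕ) (x v : ℕ), 6 ≤ x → (∀ i < 6, τ i = σ i) →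
      ∀ i < 6, Function.update τ x v i = σ i := by
    intro τ x v hx h i hi
    rw [Function.update_of_ne (by omega), h i hi]
  induction P with
  | skip => intro C hC C' h; simp_all [run, Config.tick, cost]
  | assign x e =>
    intro C hC C' h
    simp only [run, List.mem_singleton] at h
    subst h
    exact ⟨upd _ _ _ hP hC, by simp [Config.set, cost]⟩
  | flip q => intro C hC C' h; simp_all [run, Config.apply, cost]
  | phase q => intro C hC C' h; simp_all [run, Config.apply, cost]
  | toffoli c₁ c₂ q => intro C hC C' h; simp_all [run, Config.apply, cost]
  | rotate c₁ c₂ q a => intro C hC C' h; simp_all [run, Config.apply, cost]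
  | measure q x =>
    intro C hC C' h
    simp only [run, List.mem_cons, List.not_mem_nil, or_false] at h
    rcases h with rfl | rfl <;>
    exact ⟨upd _ _ _ hP hC, by simp [Config.set, Config.apply, cost]⟩
  | seq P₁ P₂ ih₁ ih₂ =>
    intro C hC C' h
    simp only [run, List.mem_flatMap] at h
    obtain ⟨C₁, h₁, h₂⟩ := h
    obtain ⟨a, b⟩ := ih₁ hP.1 C hC C₁ h₁
    obtain ⟨a', b'⟩ := ih₂ hP.2 C₁ a C' h₂
    exact ⟨a', by simp only [cost, Polynomial.eval_add]; omega⟩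
  | ite e₁ e₂ P₁ P₂ ih₁ ih₂ =>
    intro C hC C' h
    simp only [run] at h
    split_ifs at h
    · obtain ⟨a, b⟩ := ih₁ hP.1 C.tick hC C' h
      refine ⟨a, ?_⟩
      simp only [cost, Polynomial.eval_add, Polynomial.eval_one, Config.tick] at b ⊢
      omega
    · obtain ⟨a, b⟩ := ih₂ hP.2 C.tick hC C' h
      refine ⟨a, ?_⟩
      simp only [cost, Polynomial.eval_add, Polynomial.eval_one, Config.tick] at b ⊢
      omega
  | loop x e P ih =>
    intro C hC C' h
    obtain ⟨hx, he, hB, hP⟩ := hP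
    simp only [run] at h
    have key : ∀ (l : List ℕ) (L : List Config) (t : ℕ),
        (∀ D ∈ L, (∀ i < 6, D.store i = σ i) ∧ D.steps ≤ t) →
        ∀ D ∈ l.foldl (fun L i => L.flatMap fun C' => P.run r (C'.set x i)) L,
          (∀ i < 6, D.store i = σ i) ∧ D.steps ≤ t + l.length * (1 + P.cost.eval B) := by
      intro l
      induction l with
      | nil => intro L t hL D hD; simpa using hL D hD
      | cons i l ihl =>
        intro L t hL D hD
        rw [List.foldl_cons] at hD
        have := ihl _ (t + (1 + P.cost.eval B)) ?_ D hD
        · refine ⟨this.1, this.2.trans (le_of_eq ?_)⟩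
          simp only [List.length_cons]; ring
        · intro D' hD'
          obtain ⟨E, hE, hD'⟩ := List.mem_flatMap.1 hD'
          obtain ⟨a, b⟩ := hL E hE
          obtain ⟨a', b'⟩ := ih hP (E.set x i) (upd _ _ _ hx a) D' hD'
          refine ⟨a', b'.trans ?_⟩
          simp only [Config.set]; omega
    have := key _ [C.tick] (C.steps + 1) (by simpa [Config.tick] using hC) C' h
    refine ⟨this.1, this.2.trans ?_⟩
    simp only [cost, Polynomial.eval_add, Polynomial.eval_mul, Polynomial.eval_one,
      Polynomial.eval_X, List.length_range]
    rw [he.eval_congr hC]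
    nlinarith [Nat.mul_le_mul_right (1 + P.cost.eval B) hB]

/-! ### Rows of the memory -/

/-- Content of one row: the pairs `(array, column)` of the qubits that are `1`. -/
abbrev Row : Type := Finset (ℕ × ℕ)

def row (b : Finset Qubit) (k : ℕ) : Row :=
  (b.filter fun q => q.2.1 = k).image fun q => (q.1, q.2.2)

theorem mem_row {b : Finset Qubit} {k a i : ℕ} : (a, i) ∈ row b k ↔ (a, k, i) ∈ b := by
  simp only [row, Finset.mem_image, Finset.mem_filter, Prod.mk.injEq, Prod.exists]
  constructor
  · rintro ⟨a', k', i', ⟨h, rfl⟩, rfl, rfl⟩; exact h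
  · intro h; exact ⟨a, k, i, ⟨h, rfl⟩, rfl, rfl⟩

theorem row_ext {b b' : Finset Qubit} (h : ∀ k, row b k = row b' k) : b = b' := by
  ext ⟨a, k, i⟩
  rw [← mem_row, h, mem_row]

/-- Multiplication of the amplitudes by a function of row `k`. -/
def scale (k : ℕ) (d : Row → ℝ) (φ : Memory) : Memory := fun b => (d (row b k) : ℂ) * φ b

/-- The auxiliary qubits of row `k`, which are in array `0`, are zero. -/
def Clean (k : ℕ) (φ : Memory) : Prop := ∀ b, φ b ≠ 0 → ∀ i, 1 ≤ i → (0, k, i) ∉ b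

theorem Clean.scale {k : ℕ} {φ : Memory} (h : Clean k φ) (d : Row → ℝ) :
    Clean k (scale k d φ) := fun b hb => h b fun h0 => hb (by simp [EDCP.scale, h0])

theorem scale_scale (k : ℕ) (d d' : Row → ℝ) (φ : Memory) :
    scale k d (scale k d' φ) = scale k (fun A => d' A * d A) φ := by
  funext b; simp only [scale]; push_cast; ring

theorem scale_one (k : ℕ) (φ : Memory) : scale k (fun _ => 1) φ = φ := by
  funext b; simp [scale]

/-- `T`, which transforms payoffs, is a measurement of row `k` whose branches multiply the amplitudes
by functions of the content of the row. One branch, with the function `m`, preserves the classical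
flag, all others set it to `0`. The store is `S ok` before and `S' ok` afterwards, when the flag is
`ok`. -/
def WeakTransformer (k : ℕ)
    (T : ((ℕ → ℕ) → Memory → ℝ≥0∞) → (ℕ → ℕ) → Memory → ℝ≥0∞)
    (S S' : ℕ → ℕ → ℕ) (m : Row → ℝ) : Prop :=
  ∃ ds : List (Row → ℝ), (∀ A, m A ^ 2 + (ds.map fun d => d A ^ 2).sum = 1) ∧
    ∀ φ, Clean k φ → ∀ Q, ∀ ok ≤ 1, T Q (S ok) φ =
      Q (S' ok) (scale k m φ) + (ds.map fun d => Q (S' 0) (scale k d φ)).sum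

/-- The only branch that keeps the flag is success followed by success. The other products are
success followed by failure, and failure followed by anything; since the flag is already `0` in the
latter case, the distinguished branch of the second measurement is just one more failing branch. -/
theorem WeakTransformer.comp {k : ℕ}
    {T₁ T₂ : ((ℕ → ℕ) → Memory → ℝ≥0∞) → (ℕ → ℕ) → Memory → ℝ≥0∞}
    {S S' S'' : ℕ → ℕ → ℕ} {m₁ m₂ : Row → ℝ}
    (h₁ : WeakTransformer k T₁ S S' m₁) (h₂ : WeakTransformer k T₂ S' S'' m₂) :
    WeakTransformer k (fun Q => T₁ (T₂ Q)) S S'' (fun A => m₁ A * m₂ A) := by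
  obtain ⟨d₁, hd₁, h₁⟩ := h₁
  obtain ⟨d₂, hd₂, h₂⟩ := h₂
  refine ⟨(d₂.map fun d A => m₁ A * d A) ++
    d₁.flatMap (fun d => (fun A => d A * m₂ A) :: d₂.map fun d' A => d A * d' A), ?_, ?_⟩
  · intro A
    have e1 : ∀ c : ℝ, (d₂.map fun d => (c * d A) ^ 2).sum = c ^ 2 * (1 - m₂ A ^ 2) := by
      intro c
      simp only [mul_pow, List.sum_map_mul_left]
      rw [← hd₂ A]; ring
    have e2 : ∀ L : List (Row → ℝ), ((L.flatMap fun d => (fun A => d A * m₂ A) ::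
        d₂.map fun d' A => d A * d' A).map fun d => d A ^ 2).sum =
        (L.map fun d => d A ^ 2).sum := by
      intro L
      induction L with
      | nil => simp
      | cons d L ih =>
        simp only [List.flatMap_cons, List.map_append, List.sum_append, ih, List.map_cons,
          List.sum_cons, List.map_map, Function.comp_def, e1]
        ring
    simp only [List.map_append, List.sum_append, e2, List.map_map, Function.comp_def, e1]
    linear_combination hd₁ A
  · intro φ hφ Q ok hok
    change T₁ (T₂ Q) (S ok) φ = _
    rw [h₁ φ hφ _ ok hok, h₂ _ (hφ.scale _) Q ok hok]
    have e3 : ∀ L : List (Row → ℝ),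
        (L.map fun d => T₂ Q (S' 0) (EDCP.scale k d φ)).sum =
        ((L.flatMap fun d => (fun A => d A * m₂ A) :: d₂.map fun d' A => d A * d' A).map
          fun d => Q (S'' 0) (EDCP.scale k d φ)).sum := by
      intro L
      induction L with
      | nil => simp
      | cons d L ih =>
        simp only [List.map_cons, List.sum_cons, List.flatMap_cons, List.map_append,
          List.sum_append, ih, h₂ _ (hφ.scale d) Q 0 (by omega), scale_scale, List.map_map,
          Function.comp_def]
    rw [e3]
    simp only [List.map_append, List.sum_append, scale_scale, List.map_map, Function.comp_def,
      add_assoc]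

/-- The program `P` is a measurement of row `k` in the sense of `WeakTransformer`. -/
def WeakSpec (r : ℝ) (k : ℕ) (P : Program) (S S' : ℕ → ℕ → ℕ) (m : Row → ℝ) : Prop :=
  WeakTransformer k (P.wp r) S S' m

theorem WeakSpec.congr {r : ℝ} {k : ℕ} {P : Program} {S S' : ℕ → ℕ → ℕ} {m m' : Row → ℝ}
    (h : WeakSpec r k P S S' m) (hm : ∀ A, m A = m' A) : WeakSpec r k P S S' m' := by
  obtain rfl : m = m' := funext hm
  exact h

theorem WeakSpec.seq {r : ℝ} {k : ℕ} {P₁ P₂ : Program} {S S' S'' : ℕ → ℕ → ℕ} {m₁ m₂ : Row → ℝ}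
    (h₁ : WeakSpec r k P₁ S S' m₁) (h₂ : WeakSpec r k P₂ S' S'' m₂) :
    WeakSpec r k (.seq P₁ P₂) S S'' (fun A => m₁ A * m₂ A) :=
  WeakTransformer.comp (T₁ := P₁.wp r) (T₂ := P₂.wp r) h₁ h₂

theorem WeakSpec.of_det {r : ℝ} {k : ℕ} {P : Program} {S S' : ℕ → ℕ → ℕ}
    (h : ∀ φ Q, ∀ ok ≤ 1, P.wp r Q (S ok) φ = Q (S' ok) φ) :
    WeakSpec r k P S S' (fun _ => 1) :=
  ⟨[], by simp, fun φ _ Q ok hok => by simp [h φ Q ok hok, scale_one]⟩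

theorem WeakSpec.loop {r : ℝ} {k : ℕ} {P : Program} {x : ℕ} {e : NExpr} (S : ℕ → ℕ → ℕ → ℕ)
    (m : ℕ → Row → ℝ) (n : ℕ) (hn : ∀ ok ≤ 1, e.eval (S 0 ok) = n)
    (h : ∀ i < n, WeakSpec r k P (fun ok => Function.update (S i ok) x i) (S (i + 1)) (m i)) :
    WeakSpec r k (.loop x e P) (S 0) (S n) (fun A => ∏ i ∈ Finset.range n, m i A) := by
  have key : ∀ l i, i + l = n → WeakTransformer k
      (fun Q => (List.range' i l).foldr (fun i K σ ψ => P.wp r K (Function.update σ x i) ψ) Q)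
      (S i) (S n) (fun A => ∏ j ∈ Finset.Ico i n, m j A) := by
    intro l
    induction l with
    | zero =>
      intro i hi
      obtain rfl : i = n := by omega
      exact ⟨[], by simp, fun φ _ Q ok _ => by simp [scale_one]⟩
    | succ l ih =>
      intro i hi
      have h₁ : WeakTransformer k (fun Q σ ψ => P.wp r Q (Function.update σ x i) ψ)
        (S i) (S (i + 1)) (m i) := h i (by omega)
      simp only [List.range'_succ, List.foldr_cons,
        Finset.prod_eq_prod_Ico_succ_bot (show i < n by omega)]
      exact h₁.comp (ih (i + 1) (by omega))
  obtain ⟨ds, hds, hd⟩ := key n 0 (by omega)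
  simp only [← Finset.range_eq_Ico] at hds hd
  refine ⟨ds, hds, fun φ hφ Q ok hok => ?_⟩
  simp only [Program.wp, hn ok hok, List.range_eq_range']
  exact hd φ hφ Q ok hok

/-! ### Permutations of the qubits -/

def permute (τ : Equiv.Perm Qubit) (ψ : Memory) : Memory := fun b => ψ (b.map τ.toEmbedding)

theorem permute_permute (τ τ' : Equiv.Perm Qubit) (ψ : Memory) :
    permute τ' (permute τ ψ) = permute (τ * τ') ψ := by
  funext b
  simp only [permute, Finset.map_map]
  rfl

theorem permute_one (ψ : Memory) : permute 1 ψ = ψ := by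
  funext b
  simp only [permute]
  congr 1
  exact Finset.map_refl

theorem row_map_of_fix {τ : Equiv.Perm Qubit} {k : ℕ} (h : ∀ a i, τ (a, k, i) = (a, k, i))
    (b : Finset Qubit) : row (b.map τ.toEmbedding) k = row b k := by
  ext ⟨a, i⟩
  rw [mem_row, mem_row, Finset.mem_map_equiv, (Equiv.symm_apply_eq τ).2 (h a i).symm]

/-- Measuring a row that has not been moved commutes with all earlier moves, so the permutation can
always be kept outermost. -/
theorem scale_permute {τ : Equiv.Perm Qubit} {k : ℕ} (h : ∀ a i, τ (a, k, i) = (a, k, i))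
    (d : Row → ℝ) (ψ : Memory) : scale k d (permute τ ψ) = permute τ (scale k d ψ) := by
  funext b
  simp only [scale, permute, row_map_of_fix h]

/-- Three CNOT gates exchange two qubits. -/
theorem toffoli_swap {p q : Qubit} (ψ : Memory) :
    toffoli p p q (toffoli q q p (toffoli p p q ψ)) = permute (Equiv.swap p q) ψ := by
  -- The degenerate case occurs in the reduction when an accepted row is already in its place; the
  -- gates then do nothing.
  by_cases hpq : q = p
  · subst hpq
    funext b
    simp only [toffoli, ne_eq, not_true_eq_false, false_and, if_false, permute, Equiv.swap_self]
    congr 1; ext; simp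
  · have hqp : p ≠ q := fun h => hpq h.symm
    funext b
    have hm : ∀ x, x ∈ b.map (Equiv.swap p q).toEmbedding ↔ Equiv.swap p q x ∈ b := by
      intro x; rw [Finset.mem_map_equiv, Equiv.symm_swap]
    by_cases hp : p ∈ b <;> by_cases hq : q ∈ b <;>
    · simp only [toffoli, permute, hp, hq, hpq, hqp, ne_eq, not_false_eq_true, and_self,
        if_true, if_false, Finset.mem_symmDiff, Finset.mem_singleton, not_true_eq_false,
        and_false, or_false, false_or, and_true]
      refine congrArg ψ ?_
      ext x
      rw [hm]
      by_cases hxp : x = p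
      · subst hxp; simp_all [Finset.mem_symmDiff]
      · by_cases hxq : x = q
        · subst hxq; simp_all [Finset.mem_symmDiff]
        · simp [Equiv.swap_apply_of_ne_of_ne hxp hxq, Finset.mem_symmDiff, hxp, hxq]

/-- Exchange of the qubits in rows `k` and `c` whose array and column are in `U`. -/
def rowSwap (U : Set (ℕ × ℕ)) (k c : ℕ) : Equiv.Perm Qubit :=
  open Classical in
  Function.Involutive.toPerm
    (fun q => if (q.1, q.2.2) ∈ U then (q.1, Equiv.swap k c q.2.1, q.2.2) else q) (by
      rintro ⟨a, j, i⟩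
      by_cases h : (a, i) ∈ U <;> simp [h])

theorem rowSwap_of_mem {U : Set (ℕ × ℕ)} {k c a j i : ℕ} (h : (a, i) ∈ U) :
    rowSwap U k c (a, j, i) = (a, Equiv.swap k c j, i) := by
  simp [rowSwap, Function.Involutive.toPerm, h]

theorem rowSwap_of_notMem {U : Set (ℕ × ℕ)} {k c a j i : ℕ} (h : (a, i) ∉ U) :
    rowSwap U k c (a, j, i) = (a, j, i) := by
  simp [rowSwap, Function.Involutive.toPerm, h]

theorem rowSwap_empty (k c : ℕ) : rowSwap ∅ k c = 1 := by
  ext1 ⟨a, j, i⟩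
  rw [rowSwap_of_notMem (by simp)]; rfl

/-- Lets the exchanged set grow qubit by qubit along the loops; a pair already in `U` would be
swapped back. -/
theorem rowSwap_mul_swap {U : Set (ℕ × ℕ)} {k c a i : ℕ} (h : (a, i) ∉ U) :
    rowSwap U k c * Equiv.swap (a, k, i) (a, c, i) = rowSwap (insert (a, i) U) k c := by
  ext1 ⟨a', j, i'⟩
  rw [Equiv.Perm.mul_apply]
  by_cases hai : (a', i') = (a, i)
  · simp only [Prod.mk.injEq] at hai
    obtain ⟨rfl, rfl⟩ := hai
    rw [rowSwap_of_mem (Set.mem_insert _ _)]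
    by_cases hk : j = k
    · subst hk; rw [Equiv.swap_apply_left, rowSwap_of_notMem h, Equiv.swap_apply_left]
    · by_cases hc : j = c
      · subst hc; rw [Equiv.swap_apply_right, rowSwap_of_notMem h, Equiv.swap_apply_right]
      · rw [Equiv.swap_apply_of_ne_of_ne (by simp [hk]) (by simp [hc]), rowSwap_of_notMem h,
          Equiv.swap_apply_of_ne_of_ne hk hc]
  · have h1 : ∀ j', (a', j, i') ≠ (a, j', i) := by
      intro j' h'; simp only [Prod.mk.injEq] at h'; exact hai (by simp [h'.1, h'.2.2])
    rw [Equiv.swap_apply_of_ne_of_ne (h1 _) (h1 _)]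
    by_cases hU : (a', i') ∈ U
    · rw [rowSwap_of_mem hU, rowSwap_of_mem (Set.mem_insert_of_mem _ hU)]
    · rw [rowSwap_of_notMem hU, rowSwap_of_notMem (by simp [hU, hai])]

/-! ### Product states -/

/-- The memory whose rows `k < ℓ` are in the states `f k`, the other rows being zero. -/
def prodState {ℓ : ℕ} (f : Fin ℓ → Row → ℂ) : Memory := fun b =>
  if ∀ q ∈ b, q.2.1 < ℓ then ∏ k : Fin ℓ, f k (row b k) else 0

theorem scale_prodState {ℓ : ℕ} (f : Fin ℓ → Row → ℂ) (k : Fin ℓ) (d : Row → ℝ) :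
    scale k d (prodState f) =
      prodState (Function.update f k fun A => (d A : ℂ) * f k A) := by
  funext b
  simp only [scale, prodState]
  split_ifs with h
  · rw [← Finset.mul_prod_erase _ _ (Finset.mem_univ k),
      ← Finset.mul_prod_erase _ _ (Finset.mem_univ k), Function.update_self, mul_assoc]
    congr 2
    apply Finset.prod_congr rfl
    intro j hj
    rw [Function.update_of_ne (Finset.ne_of_mem_erase hj)]
  · simp

/-- Supplies the zero auxiliary qubits for a row that is about to be measured. -/
theorem clean_permute_prodState {ℓ : ℕ} {f : Fin ℓ → Row → ℂ} {k : Fin ℓ}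
    {τ : Equiv.Perm Qubit} (hτ : ∀ a i, τ (a, (k : ℕ), i) = (a, (k : ℕ), i))
    (h : ∀ A, f k A ≠ 0 → ∀ i, 1 ≤ i → (0, i) ∉ A) : Clean k (permute τ (prodState f)) := by
  intro b hb i hi hmem
  simp only [permute, prodState] at hb
  split_ifs at hb with h'
  · have := Finset.prod_ne_zero_iff.1 hb k (Finset.mem_univ k)
    rw [row_map_of_fix hτ] at this
    exact h _ this i hi (mem_row.2 hmem)
  · exact hb rfl

/-! ### The program -/

/-- The parameters in the classical variables `0, …, 5`. -/
structure Params where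
  (κ n N ℓ ℓ' M : ℕ)

/-- The store of the reduction. Beyond the parameters, it holds the number `cnt` of successful rows,
the current row `k`, the flag `ok`, the last measurement outcome `x`, two loop indices `i` and `a`,
two powers of two, and two variables for the extraction of the bits of `M - 1`. -/
def st (p : Params) (cnt k ok x i a pa pb u y : ℕ) : ℕ → ℕ := fun v =>
  [p.κ, p.n, p.N, p.ℓ, p.ℓ', p.M, cnt, k, ok, x, i, a, pa, pb, u, y].getD v 0

theorem update_getD (l : List ℕ) (x v : ℕ) (h : x < l.length) :
    Function.update (fun i => l.getD i 0) x v = fun i => (l.set x v).getD i 0 := by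
  funext j
  by_cases hj : j = x
  · subst hj; simp [h]
  · rw [Function.update_of_ne hj]
    simp [List.getElem?_set_ne (Ne.symm hj)]

section
variable (p : Params) (cnt k ok x i a pa pb u y v : ℕ)

@[simp] theorem st_zero : st p cnt k ok x i a pa pb u y 0 = p.κ := rfl
@[simp] theorem st_one : st p cnt k ok x i a pa pb u y 1 = p.n := rfl
@[simp] theorem st_two : st p cnt k ok x i a pa pb u y 2 = p.N := rfl
@[simp] theorem st_three : st p cnt k ok x i a pa pb u y 3 = p.ℓ := rfl
@[simp] theorem st_five : st p cnt k ok x i a pa pb u y 5 = p.M := rfl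
@[simp] theorem st_six : st p cnt k ok x i a pa pb u y 6 = cnt := rfl
@[simp] theorem st_seven : st p cnt k ok x i a pa pb u y 7 = k := rfl
@[simp] theorem st_eight : st p cnt k ok x i a pa pb u y 8 = ok := rfl
@[simp] theorem st_nine : st p cnt k ok x i a pa pb u y 9 = x := rfl
@[simp] theorem st_ten : st p cnt k ok x i a pa pb u y 10 = i := rfl
@[simp] theorem st_eleven : st p cnt k ok x i a pa pb u y 11 = a := rfl
@[simp] theorem st_twelve : st p cnt k ok x i a pa pb u y 12 = pa := rfl
@[simp] theorem st_thirteen : st p cnt k ok x i a pa pb u y 13 = pb := rfl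
@[simp] theorem st_fourteen : st p cnt k ok x i a pa pb u y 14 = u := rfl
@[simp] theorem st_fifteen : st p cnt k ok x i a pa pb u y 15 = y := rfl

@[simp] theorem update_st_six : Function.update (st p cnt k ok x i a pa pb u y) 6 v =
    st p v k ok x i a pa pb u y := update_getD _ _ _ (by simp)
@[simp] theorem update_st_seven : Function.update (st p cnt k ok x i a pa pb u y) 7 v =
    st p cnt v ok x i a pa pb u y := update_getD _ _ _ (by simp)
@[simp] theorem update_st_eight : Function.update (st p cnt k ok x i a pa pb u y) 8 v =
    st p cnt k v x i a pa pb u y := update_getD _ _ _ (by simp)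
@[simp] theorem update_st_nine : Function.update (st p cnt k ok x i a pa pb u y) 9 v =
    st p cnt k ok v i a pa pb u y := update_getD _ _ _ (by simp)
@[simp] theorem update_st_ten : Function.update (st p cnt k ok x i a pa pb u y) 10 v =
    st p cnt k ok x v a pa pb u y := update_getD _ _ _ (by simp)
@[simp] theorem update_st_eleven : Function.update (st p cnt k ok x i a pa pb u y) 11 v =
    st p cnt k ok x i v pa pb u y := update_getD _ _ _ (by simp)
@[simp] theorem update_st_twelve : Function.update (st p cnt k ok x i a pa pb u y) 12 v =
    st p cnt k ok x i a v pb u y := update_getD _ _ _ (by simp)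
@[simp] theorem update_st_thirteen : Function.update (st p cnt k ok x i a pa pb u y) 13 v =
    st p cnt k ok x i a pa v u y := update_getD _ _ _ (by simp)
@[simp] theorem update_st_fourteen : Function.update (st p cnt k ok x i a pa pb u y) 14 v =
    st p cnt k ok x i a pa pb v y := update_getD _ _ _ (by simp)
@[simp] theorem update_st_fifteen : Function.update (st p cnt k ok x i a pa pb u y) 15 v =
    st p cnt k ok x i a pa pb u v := update_getD _ _ _ (by simp)

end

infixr:60 " ;; " => Program.seq

/-- A loop that resets its index after each iteration. -/
def forLoop (x : ℕ) (e : NExpr) (P : Program) : Program := .loop x e (P ;; .assign x (.lit 0))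

/-- The number of bits for `{0, …, M - 1}`. -/
def lowBits : NExpr := .clog (.var 5)

/-- The number of further bits that are checked to be zero. -/
def highBits : NExpr := .add lowBits (.add (.var 0) (.var 3))

/-- Measure `q`, and clear the flag if the outcome is `1`. -/
def kill (q : QExpr) : Program :=
  .measure q 9 ;; .assign 8 (.sub (.var 8) (.var 9)) ;; .assign 9 (.lit 0)

def auxControl : QExpr := ⟨.lit 0, .var 7, .lit 1⟩
def auxTarget : QExpr := ⟨.lit 0, .var 7, .lit 2⟩
def flagQubit (e : NExpr) : QExpr := ⟨.lit 0, .var 7, .add (.lit 3) e⟩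
def numQubit (e : NExpr) : QExpr := ⟨.lit 1, .var 7, e⟩

def dampParam : RExpr :=
  .exp (.div (.sub (.nat (.lit 0)) (.mul .pi (.mul (.nat (.var 12)) (.nat (.var 13)))))
    (.mul .input .input))

/-- Weak measurement that multiplies the amplitude by `dampParam`, unless both bits are `1`. -/
def damp : Program :=
  .toffoli (numQubit (.var 10)) (numQubit (.var 11)) auxControl ;;
  .flip auxControl ;;
  .rotate auxControl auxControl auxTarget dampParam ;;
  .measure auxTarget 9 ;;
  .assign 8 (.sub (.var 8) (.var 9)) ;;
  .ite (.lit 1) (.var 9) (.flip auxTarget) .skip ;;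
  .assign 9 (.lit 0) ;;
  .flip auxControl ;;
  .toffoli (numQubit (.var 10)) (numQubit (.var 11)) auxControl

/-- Set variable `14` to `(M - 1) / 2 ^ i`. -/
def shiftBound : Program :=
  .assign 14 (.sub (.var 5) (.lit 1)) ;;
  forLoop 15 lowBits
    (.ite (.add (.var 15) (.lit 1)) (.var 10) (.assign 14 (.half (.var 14))) .skip)

/-- One step in the comparison of a number with `M - 1`. -/
def compareGate : Program :=
  shiftBound ;;
  .toffoli (flagQubit (.var 10)) (numQubit (.var 10)) (flagQubit (.add (.var 10) (.lit 1))) ;;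
  .ite (.var 14) (.add (.half (.var 14)) (.half (.var 14)))
    (.toffoli (flagQubit (.var 10)) (flagQubit (.var 10)) (flagQubit (.add (.var 10) (.lit 1))) ;;
     .toffoli (numQubit (.var 10)) (numQubit (.var 10)) (flagQubit (.add (.var 10) (.lit 1))))
    .skip ;;
  .assign 14 (.lit 0)

/-- Clear the flag if the number is larger than `M - 1`. -/
def compareProg : Program :=
  forLoop 10 lowBits compareGate ;;
  kill (flagQubit lowBits) ;;
  forLoop 11 lowBits
    (.assign 10 (.sub (.sub lowBits (.lit 1)) (.var 11)) ;; compareGate ;; .assign 10 (.lit 0))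

def signProg : Program := kill ⟨.lit 0, .var 7, .lit 0⟩

def highProg : Program := forLoop 10 highBits (kill (numQubit (.add lowBits (.var 10))))

/-- Flatten the Gaussian weights on `{0, …, 2 ^ lowBits - 1}`. -/
def dampProg : Program :=
  .assign 12 (.lit 1) ;;
  forLoop 10 lowBits
    (.assign 13 (.lit 1) ;;
     forLoop 11 lowBits (damp ;; .assign 13 (.add (.var 13) (.var 13))) ;;
     .assign 13 (.lit 0) ;;
     .assign 12 (.add (.var 12) (.var 12))) ;;
  .assign 12 (.lit 0)

def rowProg : Program := signProg ;; highProg ;; dampProg ;; compareProg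

/-- Exchange two qubits. -/
def swapProg (q q' : QExpr) : Program :=
  .toffoli q q q' ;; .toffoli q' q' q ;; .toffoli q q q'

/-- Exchange the rows given by the variables `7` and `6`. -/
def moveProg : Program :=
  forLoop 10 lowBits (swapProg ⟨.lit 1, .var 7, .var 10⟩ ⟨.lit 1, .var 6, .var 10⟩) ;;
  forLoop 10 (.var 1) (forLoop 11 (.clog (.var 2))
    (swapProg ⟨.add (.lit 2) (.var 10), .var 7, .var 11⟩
      ⟨.add (.lit 2) (.var 10), .var 6, .var 11⟩))

/-- The reduction: flatten the amplitudes of every row by rejection, and collect the successful rows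
in the rows `0, 1, …`. -/
def reduction : Program :=
  forLoop 7 (.var 3)
    (.assign 8 (.lit 1) ;; rowProg ;;
     .ite (.lit 1) (.var 8) (moveProg ;; .assign 6 (.add (.var 6) (.lit 1))) .skip ;;
     .assign 8 (.lit 0))

theorem reduction_bounded (κ n N ℓ ℓ' M : ℕ) :
    reduction.Bounded (fun i => [κ, n, N, ℓ, ℓ', M].getD i 0)
      (2 * (κ + n + Nat.clog 2 N + ℓ + Nat.clog 2 M)) := by
  simp only [reduction, forLoop, rowProg, signProg, highProg, dampProg, compareProg, kill, damp,
    compareGate, shiftBound, moveProg, swapProg, Program.Bounded, highBits, lowBits, NExpr.Static,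
    NExpr.eval]
  simp
  omega

/-! ### The measurement of one row -/

theorem project_false_eq_scale (a k i : ℕ) (φ : Memory) :
    project (a, k, i) false φ = scale k (fun A => if (a, i) ∈ A then 0 else 1) φ := by
  funext b
  by_cases h : (a, k, i) ∈ b <;> simp [project, scale, mem_row, h]

theorem project_true_eq_scale (a k i : ℕ) (φ : Memory) :
    project (a, k, i) true φ = scale k (fun A => if (a, i) ∈ A then 1 else 0) φ := by
  funext b
  by_cases h : (a, k, i) ∈ b <;> simp [project, scale, mem_row, h]

theorem kill_wp (r : ℝ) (q : QExpr) (Q) (p : Params) (cnt k ok i a pa pb u y : ℕ) (φ : Memory) :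
    (kill q).wp r Q (st p cnt k ok 0 i a pa pb u y) φ =
      Q (st p cnt k ok 0 i a pa pb u y)
        (project (q.eval (st p cnt k ok 0 i a pa pb u y)) false φ) +
      Q (st p cnt k (ok - 1) 0 i a pa pb u y)
        (project (q.eval (st p cnt k ok 0 i a pa pb u y)) true φ) := by
  simp [kill, Program.wp, NExpr.eval]

theorem kill_spec (r : ℝ) (q : QExpr) (p : Params) (cnt k i a pa pb u y a' i' : ℕ)
    (hq : ∀ ok, q.eval (st p cnt k ok 0 i a pa pb u y) = (a', k, i')) :
    WeakSpec r k (kill q) (fun ok => st p cnt k ok 0 i a pa pb u y)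
      (fun ok => st p cnt k ok 0 i a pa pb u y) (fun A => if (a', i') ∈ A then 0 else 1) := by
  refine ⟨[fun A => if (a', i') ∈ A then 1 else 0], ?_, ?_⟩
  · intro A; by_cases h : (a', i') ∈ A <;> simp [h]
  · intro φ _ Q ok hok
    rw [kill_wp, hq, project_false_eq_scale, project_true_eq_scale, Nat.sub_eq_zero_of_le hok]
    simp

/-- A loop in which every iteration restores the store. -/
theorem WeakSpec.forLoop {r : ℝ} {k : ℕ} {P : Program} {x : ℕ} {e : NExpr} (S : ℕ → ℕ → ℕ → ℕ)
    (S' : ℕ → ℕ → ℕ → ℕ) (m : ℕ → Row → ℝ) (n : ℕ) (hn : ∀ ok ≤ 1, e.eval (S 0 ok) = n)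
    (h : ∀ i < n, WeakSpec r k P (fun ok => Function.update (S i ok) x i) (S' i) (m i))
    (hS : ∀ i < n, ∀ ok, Function.update (S' i ok) x 0 = S (i + 1) ok) :
    WeakSpec r k (forLoop x e P) (S 0) (S n) (fun A => ∏ i ∈ Finset.range n, m i A) := by
  refine WeakSpec.loop S m n hn fun i hi => ?_
  refine ((h i hi).seq (WeakSpec.of_det (S' := S (i + 1)) ?_)).congr fun A => mul_one _
  intro φ Q ok _
  simp only [Program.wp, NExpr.eval, hS i hi]

theorem wp_forLoop_det (r : ℝ) (x : ℕ) (e : NExpr) (P : Program) (S S' : ℕ → ℕ → ℕ)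
    (G : ℕ → Memory) (n : ℕ) (hn : e.eval (S 0) = n)
    (h : ∀ i < n, ∀ Q, P.wp r Q (Function.update (S i) x i) (G i) = Q (S' i) (G (i + 1)))
    (hS : ∀ i < n, Function.update (S' i) x 0 = S (i + 1)) (Q) :
    (forLoop x e P).wp r Q (S 0) (G 0) = Q (S n) (G n) := by
  refine Program.wp_loop_det r x e _ S G n hn (fun i hi Q => ?_) Q
  simp only [Program.wp, NExpr.eval, h i hi, hS i hi]

theorem signProg_spec (r : ℝ) (p : Params) (cnt k : ℕ) :
    WeakSpec r k signProg (fun ok => st p cnt k ok 0 0 0 0 0 0 0)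
      (fun ok => st p cnt k ok 0 0 0 0 0 0 0) (fun A => if (0, 0) ∈ A then 0 else 1) :=
  kill_spec r _ p cnt k 0 0 0 0 0 0 0 0 fun ok => by simp [QExpr.eval, NExpr.eval]

theorem highProg_spec (r : ℝ) (p : Params) (cnt k : ℕ) :
    WeakSpec r k highProg (fun ok => st p cnt k ok 0 0 0 0 0 0 0)
      (fun ok => st p cnt k ok 0 0 0 0 0 0 0)
      (fun A => ∏ i ∈ Finset.range (Nat.clog 2 p.M + (p.κ + p.ℓ)),
        if (1, Nat.clog 2 p.M + i) ∈ A then 0 else 1) := by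
  refine WeakSpec.forLoop (fun _ ok => st p cnt k ok 0 0 0 0 0 0 0)
    (fun i ok => st p cnt k ok 0 i 0 0 0 0 0)
    (fun i A => if (1, Nat.clog 2 p.M + i) ∈ A then 0 else 1) _ ?_ ?_ ?_
  · intro ok _; simp [highBits, lowBits, NExpr.eval]
  · intro i _
    simp only [update_st_ten]
    exact kill_spec r _ p cnt k i 0 0 0 0 0 1 _ fun ok => by
      simp [numQubit, lowBits, QExpr.eval, NExpr.eval]
  · intro i _ ok; simp

/-- After the Toffoli gate and the flip, the control qubit is `1` unless both bits are `1`. The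
rotation then takes the target from |0⟩ to cos θ |0⟩ + sin θ |1⟩, and outcome `0` keeps the cosine.
The last two gates uncompute the control. -/
theorem damp_memory_false {k a b : ℕ} {θ : ℝ} {φ : Memory} (hφ : Clean k φ) :
    toffoli (1, k, a) (1, k, b) (0, k, 1) (flip (0, k, 1) (project (0, k, 2) false
      (rotate (0, k, 1) (0, k, 1) (0, k, 2) θ (flip (0, k, 1)
        (toffoli (1, k, a) (1, k, b) (0, k, 1) φ))))) =
    scale k (fun A => if (1, a) ∈ A ∧ (1, b) ∈ A then 1 else Real.cos θ) φ := by
  have h0 : ∀ b, (0, k, 1) ∈ b ∨ (0, k, 2) ∈ b → φ b = 0 := by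
    intro b hb
    by_contra h
    rcases hb with hb | hb
    · exact hφ b h 1 le_rfl hb
    · exact hφ b h 2 (by norm_num) hb
  funext c
  by_cases ha : (1, k, a) ∈ c <;> by_cases hb : (1, k, b) ∈ c <;>
  by_cases ht : (0, k, 1) ∈ c <;> by_cases hq : (0, k, 2) ∈ c <;>
  simp [toffoli, flip, project, rotate, scale, mem_row, Finset.mem_symmDiff, ha, hb, ht, hq, h0]

/-- Outcome `1` keeps the sine; the extra flip resets the target, so that the auxiliary qubits are
clean again for the next pair of bits. -/
theorem damp_memory_true {k a b : ℕ} {θ : ℝ} {φ : Memory} (hφ : Clean k φ) :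
    toffoli (1, k, a) (1, k, b) (0, k, 1) (flip (0, k, 1) (flip (0, k, 2)
      (project (0, k, 2) true (rotate (0, k, 1) (0, k, 1) (0, k, 2) θ (flip (0, k, 1)
        (toffoli (1, k, a) (1, k, b) (0, k, 1) φ)))))) =
    scale k (fun A => if (1, a) ∈ A ∧ (1, b) ∈ A then 0 else Real.sin θ) φ := by
  have h0 : ∀ b, (0, k, 1) ∈ b ∨ (0, k, 2) ∈ b → φ b = 0 := by
    intro b hb
    by_contra h
    rcases hb with hb | hb
    · exact hφ b h 1 le_rfl hb
    · exact hφ b h 2 (by norm_num) hb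
  have h1 : ∀ c : Finset Qubit, (0, k, 1) ∉ c → (0, k, 2) ∉ c →
      symmDiff ((symmDiff (symmDiff c {(0, k, 1)}) {(0, k, 2)}).erase (0, k, 2)) {(0, k, 1)} =
        c := by
    intro c ht hq
    ext x
    simp only [Finset.mem_symmDiff, Finset.mem_erase, Finset.mem_singleton]
    grind
  funext c
  by_cases ha : (1, k, a) ∈ c <;> by_cases hb : (1, k, b) ∈ c <;>
  by_cases ht : (0, k, 1) ∈ c <;> by_cases hq : (0, k, 2) ∈ c <;>
  simp [toffoli, flip, project, rotate, scale, mem_row, Finset.mem_symmDiff, ha, hb, ht, hq, h0, h1]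

theorem damp_spec (r : ℝ) (p : Params) (cnt k a b pa pb u y : ℕ) :
    WeakSpec r k damp (fun ok => st p cnt k ok 0 a b pa pb u y)
      (fun ok => st p cnt k ok 0 a b pa pb u y)
      (fun A => if (1, a) ∈ A ∧ (1, b) ∈ A then 1 else
        Real.exp (-(Real.pi * (pa * pb)) / (r * r))) := by
  have h1 : Real.exp (-(Real.pi * (pa * pb)) / (r * r)) ≤ 1 := by
    rw [Real.exp_le_one_iff]
    exact div_nonpos_of_nonpos_of_nonneg (by simp; positivity) (mul_self_nonneg r)
  have hcos := Real.cos_arccos (by linarith [Real.exp_pos (-(Real.pi * (pa * pb)) / (r * r))]) h1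
  set θ := Real.arccos (Real.exp (-(Real.pi * (pa * pb)) / (r * r))) with hθ
  rw [← hcos]
  refine ⟨[fun A => if (1, a) ∈ A ∧ (1, b) ∈ A then 0 else Real.sin θ], ?_, ?_⟩
  · intro A
    by_cases h : (1, a) ∈ A ∧ (1, b) ∈ A
    · simp [h]
    · simp [h]
  · intro φ hφ Q ok hok
    have e : dampParam.eval r (st p cnt k ok 0 a b pa pb u y) =
        Real.exp (-(Real.pi * (pa * pb)) / (r * r)) := by
      simp [dampParam, RExpr.eval, NExpr.eval]
    rw [← damp_memory_false hφ]
    simp only [List.map_cons, List.map_nil, List.sum_cons, List.sum_nil, add_zero]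
    rw [← damp_memory_true hφ]
    simp [damp, Program.wp, NExpr.eval, QExpr.eval, numQubit, auxControl, auxTarget, e, ← hθ,
      Nat.sub_eq_zero_of_le hok]

theorem dampProg_spec (r : ℝ) (p : Params) (cnt k : ℕ) :
    WeakSpec r k dampProg (fun ok => st p cnt k ok 0 0 0 0 0 0 0)
      (fun ok => st p cnt k ok 0 0 0 0 0 0 0)
      (fun A => ∏ a ∈ Finset.range (Nat.clog 2 p.M), ∏ b ∈ Finset.range (Nat.clog 2 p.M),
        if (1, a) ∈ A ∧ (1, b) ∈ A then 1 else
          Real.exp (-(Real.pi * (2 ^ a * 2 ^ b)) / (r * r))) := by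
  have inner : ∀ i, WeakSpec r k
      (forLoop 11 lowBits (damp ;; .assign 13 (.add (.var 13) (.var 13))))
      (fun ok => st p cnt k ok 0 i 0 (2 ^ i) (2 ^ 0) 0 0)
      (fun ok => st p cnt k ok 0 i 0 (2 ^ i) (2 ^ (Nat.clog 2 p.M)) 0 0)
      (fun A => ∏ b ∈ Finset.range (Nat.clog 2 p.M),
        if (1, i) ∈ A ∧ (1, b) ∈ A then 1 else
          Real.exp (-(Real.pi * (2 ^ i * 2 ^ b)) / (r * r))) := by
    intro i
    refine WeakSpec.forLoop (fun b ok => st p cnt k ok 0 i 0 (2 ^ i) (2 ^ b) 0 0)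
      (fun b ok => st p cnt k ok 0 i b (2 ^ i) (2 ^ (b + 1)) 0 0)
      (fun b A => if (1, i) ∈ A ∧ (1, b) ∈ A then 1 else
          Real.exp (-(Real.pi * (2 ^ i * 2 ^ b)) / (r * r))) _ ?_ ?_ ?_
    · intro ok _; simp [lowBits, NExpr.eval]
    · intro b _
      simp only [update_st_eleven]
      refine ((damp_spec r p cnt k i b (2 ^ i) (2 ^ b) 0 0).seq (WeakSpec.of_det ?_)).congr ?_
      · intro φ Q ok _
        simp [Program.wp, NExpr.eval, pow_succ, mul_two]
      · intro A; simp
    · intro b _ ok; simp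
  have outer : WeakSpec r k (forLoop 10 lowBits
      (.assign 13 (.lit 1) ;;
       forLoop 11 lowBits (damp ;; .assign 13 (.add (.var 13) (.var 13))) ;;
       .assign 13 (.lit 0) ;;
       .assign 12 (.add (.var 12) (.var 12))))
      (fun ok => st p cnt k ok 0 0 0 (2 ^ 0) 0 0 0)
      (fun ok => st p cnt k ok 0 0 0 (2 ^ (Nat.clog 2 p.M)) 0 0 0)
      (fun A => ∏ a ∈ Finset.range (Nat.clog 2 p.M), ∏ b ∈ Finset.range (Nat.clog 2 p.M),
        if (1, a) ∈ A ∧ (1, b) ∈ A then 1 else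
          Real.exp (-(Real.pi * (2 ^ a * 2 ^ b)) / (r * r))) := by
    refine WeakSpec.forLoop (fun a ok => st p cnt k ok 0 0 0 (2 ^ a) 0 0 0)
      (fun a ok => st p cnt k ok 0 a 0 (2 ^ (a + 1)) 0 0 0)
      (fun a A => ∏ b ∈ Finset.range (Nat.clog 2 p.M), if (1, a) ∈ A ∧ (1, b) ∈ A then 1 else
          Real.exp (-(Real.pi * (2 ^ a * 2 ^ b)) / (r * r))) _ ?_ ?_ ?_
    · intro ok _; simp [lowBits, NExpr.eval]
    · intro a _
      simp only [update_st_ten]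
      refine ((WeakSpec.of_det ?_).seq ((inner a).seq
        (WeakSpec.of_det (P := .assign 13 (.lit 0) ;; .assign 12 (.add (.var 12) (.var 12)))
          ?_))).congr ?_
      · intro φ Q ok _; simp [Program.wp, NExpr.eval]
      · intro φ Q ok _; simp [Program.wp, NExpr.eval, pow_succ, mul_two]
      · intro A; simp
    · intro a _ ok; simp
  refine ((WeakSpec.of_det ?_).seq (outer.seq (WeakSpec.of_det ?_))).congr ?_
  · intro φ Q ok _; simp [Program.wp, NExpr.eval]
  · intro φ Q ok _; simp [Program.wp, NExpr.eval]
  · intro A; simp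

/-! ### Comparison with `M - 1` -/

open Classical in
/-- The gate that computes bit `i + 1` of the chain of flags. -/
def chainGate (m k i : ℕ) (b : Finset Qubit) : Finset Qubit :=
  if (if m.testBit i then (0, k, 3 + i) ∈ b ∧ (1, k, i) ∈ b
      else (0, k, 3 + i) ∈ b ∨ (1, k, i) ∈ b) then symmDiff b {(0, k, 3 + (i + 1))} else b

/-- The first `i` gates of the chain. -/
def chain (m k : ℕ) : ℕ → Finset Qubit → Finset Qubit
  | 0, b => b
  | i + 1, b => chainGate m k i (chain m k i b)

/-- The number in a row, reduced modulo `2 ^ i`, is larger than `m` modulo `2 ^ i`. -/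
def RowGt (m : ℕ) (A : Row) : ℕ → Prop
  | 0 => False
  | i + 1 => if m.testBit i then RowGt m A i ∧ (1, i) ∈ A else RowGt m A i ∨ (1, i) ∈ A

/-- Each gate adds its value modulo 2 to the next flag qubit. The second clause says that this qubit
is still zero, so the value is written there. The flag in column 3 is never set and represents the
empty comparison. -/
theorem chain_spec {m k : ℕ} {b : Finset Qubit} (hb : ∀ i, 1 ≤ i → (0, k, i) ∉ b) (i : ℕ) :
    (∀ j, (1, k, j) ∈ chain m k i b ↔ (1, k, j) ∈ b) ∧
    (∀ j, 3 + i < j → (0, k, j) ∉ chain m k i b) ∧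
    ((0, k, 3 + i) ∈ chain m k i b ↔ RowGt m (row b k) i) := by
  induction i with
  | zero => exact ⟨fun j => Iff.rfl, fun j hj => hb j (by omega), by simp [chain, RowGt, hb]⟩
  | succ i ih =>
    obtain ⟨h1, h2, h3⟩ := ih
    have h4 := h2 (3 + (i + 1)) (by omega)
    simp only [chain, chainGate, RowGt, mem_row, h1, h3]
    refine ⟨fun j => ?_, fun j hj => ?_, ?_⟩
    · split_ifs <;> simp [Finset.mem_symmDiff, h1]
    · have h5 := h2 j (by omega)
      have h6 : j ≠ 3 + (i + 1) := by omega
      split_ifs <;> simp [Finset.mem_symmDiff, h5, h6]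
    · split_ifs with h h' h' <;> simp_all [Finset.mem_symmDiff]

/-- The loop length must not depend on `i`, so the loop runs through all low positions and halves
only in the first `i` rounds; hence the `min` in the invariant. -/
theorem shiftBound_wp (r : ℝ) (Q) (p : Params) (cnt k ok i a pa pb : ℕ) (φ : Memory)
    (hi : i ≤ Nat.clog 2 p.M) :
    shiftBound.wp r Q (st p cnt k ok 0 i a pa pb 0 0) φ =
      Q (st p cnt k ok 0 i a pa pb ((p.M - 1) / 2 ^ i) 0) φ := by
  have := wp_forLoop_det r 15 lowBits
    (.ite (.add (.var 15) (.lit 1)) (.var 10) (.assign 14 (.half (.var 14))) .skip)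
    (fun y => st p cnt k ok 0 i a pa pb ((p.M - 1) / 2 ^ min y i) 0)
    (fun y => st p cnt k ok 0 i a pa pb ((p.M - 1) / 2 ^ min (y + 1) i) y)
    (fun _ => φ) (Nat.clog 2 p.M) (by simp [lowBits, NExpr.eval]) ?_ (by simp) Q
  · simp only [shiftBound, Program.wp, NExpr.eval, st_five, update_st_fourteen]
    simpa [hi] using this
  · intro y _ Q
    simp only [update_st_fifteen, Program.wp, NExpr.eval, st_fifteen, st_ten, st_fourteen,
      update_st_fourteen]
    split_ifs with h
    · rw [min_eq_left (by omega), min_eq_left h, Nat.div_div_eq_div_mul, pow_succ]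
    · rw [min_eq_right (by omega), min_eq_right (by omega)]

/-- When bit `i` of M - 1 is one, the new flag is the conjunction computed by the Toffoli gate.
Otherwise it is the disjunction, and x ∨ y = xy ⊕ x ⊕ y accounts for the two further CNOT gates. -/
theorem compareGate_wp (r : ℝ) (Q) (p : Params) (cnt k ok i a pa pb : ℕ) (φ : Memory)
    (hi : i ≤ Nat.clog 2 p.M) :
    compareGate.wp r Q (st p cnt k ok 0 i a pa pb 0 0) φ =
      Q (st p cnt k ok 0 i a pa pb 0 0) (fun b => φ (chainGate (p.M - 1) k i b)) := by
  -- The program tests parity by u ≤ ⌊u/2⌋ + ⌊u/2⌋, which holds exactly for even u.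
  have hbit : (p.M - 1) / 2 ^ i ≤ (p.M - 1) / 2 ^ i / 2 + (p.M - 1) / 2 ^ i / 2 ↔
      (p.M - 1).testBit i = false := by
    rw [Nat.testBit_eq_decide_div_mod_eq, decide_eq_false_iff_not]
    omega
  simp only [compareGate, Program.wp]
  rw [shiftBound_wp r _ p cnt k ok i a pa pb φ hi]
  simp only [NExpr.eval, QExpr.eval, flagQubit, numQubit, st_seven, st_ten, st_fourteen,
    update_st_fourteen, hbit]
  split_ifs with h
  · congr 1
    funext b
    by_cases h1 : (0, k, 3 + i) ∈ b <;> by_cases h2 : (1, k, i) ∈ b <;>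
    simp [toffoli, chainGate, h, h1, h2, Finset.mem_symmDiff]
  · congr 1
    funext b
    rw [Bool.not_eq_false] at h
    by_cases h1 : (0, k, 3 + i) ∈ b <;> by_cases h2 : (1, k, i) ∈ b <;>
    simp [toffoli, chainGate, h, h1, h2]

/-- Compute, measure, uncompute. The gates permute basis states, so conjugating the projection on
the last flag by the chain gives a function of the row's content. The uncomputation runs for both
outcomes. -/
theorem compareProg_spec (r : ℝ) (p : Params) (cnt k : ℕ) :
    WeakSpec r k compareProg (fun ok => st p cnt k ok 0 0 0 0 0 0 0)
      (fun ok => st p cnt k ok 0 0 0 0 0 0 0)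
      (fun A => open Classical in
        if RowGt (p.M - 1) A (Nat.clog 2 p.M) then 0 else 1) := by
  classical
  set B := Nat.clog 2 p.M with hB
  set m := p.M - 1 with hm
  refine ⟨[fun A => if RowGt m A B then 1 else 0], ?_, ?_⟩
  · intro A; by_cases h : RowGt m A B <;> simp [h]
  intro φ hφ Q ok hok
  -- the inverse of the chain
  let inv : ℕ → Finset Qubit → Finset Qubit := fun i => Nat.rec id (fun j f b => f (chainGate m k j b)) i
  -- A gate's target is not among its controls, so the gate is an involution.
  have hgate : ∀ i b, chainGate m k i (chainGate m k i b) = b := by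
    intro i b
    have h : ∀ q, q ≠ (0, k, 3 + (i + 1)) → (q ∈ symmDiff b {(0, k, 3 + (i + 1))} ↔ q ∈ b) := by
      intro q hq; simp [Finset.mem_symmDiff, hq]
    simp only [chainGate]
    split_ifs with h1 h2 h3 h4 h5 <;> simp_all [Finset.mem_symmDiff]
  have hinv : ∀ i b, inv i (chain m k i b) = b := by
    intro i
    induction i with
    | zero => intro b; rfl
    | succ i ih =>
      intro b
      show inv i (chainGate m k i (chainGate m k i (chain m k i b))) = b
      rw [hgate, ih]
  have forward : ∀ Q, (forLoop 10 lowBits compareGate).wp r Q (st p cnt k ok 0 0 0 0 0 0 0) φ =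
      Q (st p cnt k ok 0 0 0 0 0 0 0) (fun b => φ (inv B b)) := by
    intro Q
    refine wp_forLoop_det r 10 lowBits compareGate (fun _ => st p cnt k ok 0 0 0 0 0 0 0)
      (fun i => st p cnt k ok 0 i 0 0 0 0 0) (fun i b => φ (inv i b)) B
      (by simp [lowBits, NExpr.eval, hB]) ?_ (by simp) Q
    intro i hi Q
    rw [update_st_ten, compareGate_wp r Q p cnt k ok i 0 0 0 _ hi.le]
  have backward : ∀ ok Q χ, (forLoop 11 lowBits
      (.assign 10 (.sub (.sub lowBits (.lit 1)) (.var 11)) ;; compareGate ;;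
        .assign 10 (.lit 0))).wp r Q (st p cnt k ok 0 0 0 0 0 0 0) χ =
      Q (st p cnt k ok 0 0 0 0 0 0 0) (fun b => χ (chain m k B b)) := by
    intro ok Q χ
    -- The memory after the last `i` gates of the chain have been undone; the loop counts up while
    -- the gate index `B - 1 - j` counts down.
    let G : ℕ → Memory := fun i =>
      Nat.rec χ (fun j ψ b => ψ (chainGate m k (B - 1 - j) b)) i
    have hG : ∀ i ≤ B, ∀ b, G i (chain m k (B - i) b) = χ (chain m k B b) := by
      intro i
      induction i with
      | zero => intro _ b; rfl
      | succ i ih =>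
        intro hi b
        rw [← ih (by omega) b]
        show G i (chainGate m k (B - 1 - i) (chain m k (B - (i + 1)) b)) = _
        rw [show B - i = (B - 1 - i) + 1 by omega, show B - (i + 1) = B - 1 - i by omega]
        rfl
    have := wp_forLoop_det r 11 lowBits
      (.assign 10 (.sub (.sub lowBits (.lit 1)) (.var 11)) ;; compareGate ;; .assign 10 (.lit 0))
      (fun _ => st p cnt k ok 0 0 0 0 0 0 0)
      (fun i => st p cnt k ok 0 0 i 0 0 0 0) G B
      (by simp [lowBits, NExpr.eval, hB]) ?_ (by simp) Q
    · refine this.trans ?_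
      congr 1
      funext b
      simpa [chain] using hG B le_rfl b
    · intro i hi Q
      simp only [Program.wp, update_st_eleven, update_st_ten, NExpr.eval, lowBits, st_five,
        st_eleven]
      rw [compareGate_wp r _ p cnt k ok _ i 0 0 _ (by omega)]
      simp only [update_st_ten]
      rfl
  simp only [compareProg, Program.wp]
  rw [forward, kill_wp, backward, backward, Nat.sub_eq_zero_of_le hok]
  have hq : (flagQubit lowBits).eval (st p cnt k ok 0 0 0 0 0 0 0) = (0, k, 3 + B) := by
    simp [flagQubit, lowBits, QExpr.eval, NExpr.eval, hB]
  simp only [hq, List.map_cons, List.map_nil, List.sum_cons, List.sum_nil, add_zero]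
  congr 2 <;>
  · funext b
    simp only [project, scale, hinv]
    by_cases hb : φ b = 0
    · simp [hb]
    · have hc := (chain_spec (m := m) (hφ b hb) B).2.2
      by_cases h : RowGt m (row b k) B <;> simp [h, hc]

theorem rowProg_spec (r : ℝ) (p : Params) (cnt k : ℕ) :
    WeakSpec r k rowProg (fun ok => st p cnt k ok 0 0 0 0 0 0 0)
      (fun ok => st p cnt k ok 0 0 0 0 0 0 0)
      (fun A => open Classical in (if (0, 0) ∈ A then 0 else 1) *
        ((∏ i ∈ Finset.range (Nat.clog 2 p.M + (p.κ + p.ℓ)),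
          if (1, Nat.clog 2 p.M + i) ∈ A then 0 else 1) *
        ((∏ a ∈ Finset.range (Nat.clog 2 p.M), ∏ b ∈ Finset.range (Nat.clog 2 p.M),
          if (1, a) ∈ A ∧ (1, b) ∈ A then 1 else
            Real.exp (-(Real.pi * (2 ^ a * 2 ^ b)) / (r * r))) *
        if RowGt (p.M - 1) A (Nat.clog 2 p.M) then 0 else 1))) :=
  (signProg_spec r p cnt k).seq ((highProg_spec r p cnt k).seq
    ((dampProg_spec r p cnt k).seq (compareProg_spec r p cnt k)))

/-! ### Moving a row -/

/-- Arrays and columns of the qubits that hold a number below `2 ^ clog M` and `n` coordinates. -/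
def lowSet (n N M : ℕ) : Set (ℕ × ℕ) :=
  {w | (w.1 = 1 ∧ w.2 < Nat.clog 2 M) ∨ (2 ≤ w.1 ∧ w.1 < 2 + n ∧ w.2 < Nat.clog 2 N)}

theorem swapProg_wp (r : ℝ) (Q) (q q' : QExpr) (σ : ℕ → ℕ) (φ : Memory) :
    (swapProg q q').wp r Q σ φ = Q σ (permute (Equiv.swap (q.eval σ) (q'.eval σ)) φ) := by
  simp only [swapProg, Program.wp, toffoli_swap]

theorem moveProg_wp (r : ℝ) (Q) (p : Params) (cnt k ok : ℕ) (φ : Memory) :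
    moveProg.wp r Q (st p cnt k ok 0 0 0 0 0 0 0) φ =
      Q (st p cnt k ok 0 0 0 0 0 0 0) (permute (rowSwap (lowSet p.n p.N p.M) k cnt) φ) := by
  set B := Nat.clog 2 p.M with hB
  set D := Nat.clog 2 p.N with hD
  -- The positions exchanged so far: `i` bits of the number, `a` complete coordinates and `b` bits
  -- of the next one.
  let U : ℕ → ℕ → ℕ → Set (ℕ × ℕ) := fun i a b =>
    {w | (w.1 = 1 ∧ w.2 < i) ∨ (2 ≤ w.1 ∧ w.1 < 2 + a ∧ w.2 < D) ∨ (w.1 = 2 + a ∧ w.2 < b)}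
  have first : ∀ Q, (forLoop 10 lowBits (swapProg ⟨.lit 1, .var 7, .var 10⟩
      ⟨.lit 1, .var 6, .var 10⟩)).wp r Q (st p cnt k ok 0 0 0 0 0 0 0) φ =
      Q (st p cnt k ok 0 0 0 0 0 0 0) (permute (rowSwap (U B 0 0) k cnt) φ) := by
    intro Q
    have h0 : permute (rowSwap (U 0 0 0) k cnt) φ = φ := by
      have : U 0 0 0 = ∅ := by
        ext ⟨w, v⟩; simp only [U, Set.mem_ofPred_eq, Set.mem_empty_iff_false, iff_false]; omega
      rw [this, rowSwap_empty, permute_one]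
    have := wp_forLoop_det r 10 lowBits
      (swapProg ⟨.lit 1, .var 7, .var 10⟩ ⟨.lit 1, .var 6, .var 10⟩)
      (fun _ => st p cnt k ok 0 0 0 0 0 0 0) (fun i => st p cnt k ok 0 i 0 0 0 0 0)
      (fun i => permute (rowSwap (U i 0 0) k cnt) φ) B
      (by simp [lowBits, NExpr.eval, hB]) ?_ (by simp) Q
    · simpa only [h0] using this
    · intro i hi Q
      rw [swapProg_wp, permute_permute]
      simp only [QExpr.eval, NExpr.eval, update_st_ten, st_seven, st_six, st_ten]
      rw [rowSwap_mul_swap (by simp [U])]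
      congr 3
      ext ⟨w, v⟩
      simp only [U, Set.mem_insert_iff, Set.mem_ofPred_eq, Prod.mk.injEq]
      omega
  have inner : ∀ a Q, (forLoop 11 (.clog (.var 2))
      (swapProg ⟨.add (.lit 2) (.var 10), .var 7, .var 11⟩
        ⟨.add (.lit 2) (.var 10), .var 6, .var 11⟩)).wp r Q (st p cnt k ok 0 a 0 0 0 0 0)
        (permute (rowSwap (U B a 0) k cnt) φ) =
      Q (st p cnt k ok 0 a 0 0 0 0 0) (permute (rowSwap (U B a D) k cnt) φ) := by
    intro a Q
    refine wp_forLoop_det r 11 _ _ (fun _ => st p cnt k ok 0 a 0 0 0 0 0)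
      (fun i => st p cnt k ok 0 a i 0 0 0 0)
      (fun i => permute (rowSwap (U B a i) k cnt) φ) D (by simp [NExpr.eval, hD]) ?_ (by simp) Q
    intro i hi Q
    rw [swapProg_wp, permute_permute]
    simp only [QExpr.eval, NExpr.eval, update_st_eleven, st_seven, st_six, st_ten, st_eleven]
    rw [rowSwap_mul_swap (by simp only [U, Set.mem_ofPred_eq]; omega)]
    congr 3
    ext ⟨w, v⟩
    simp only [U, Set.mem_insert_iff, Set.mem_ofPred_eq, Prod.mk.injEq]
    omega
  simp only [moveProg, Program.wp]
  rw [first]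
  have := wp_forLoop_det r 10 (.var 1) (forLoop 11 (.clog (.var 2))
      (swapProg ⟨.add (.lit 2) (.var 10), .var 7, .var 11⟩
        ⟨.add (.lit 2) (.var 10), .var 6, .var 11⟩))
      (fun _ => st p cnt k ok 0 0 0 0 0 0 0) (fun i => st p cnt k ok 0 i 0 0 0 0 0)
      (fun i => permute (rowSwap (U B i 0) k cnt) φ) p.n
      (by simp [NExpr.eval]) ?_ (by simp) Q
  · rw [this]
    congr 3
    ext ⟨w, v⟩
    simp only [U, lowSet, Set.mem_ofPred_eq, ← hB, ← hD]
    omega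
  · intro i hi Q
    rw [update_st_ten, inner]
    congr 3
    ext ⟨w, v⟩
    simp only [U, Set.mem_ofPred_eq]
    omega

/-! ### Instances as product states -/

/-- The content of a row that holds the pair `(j, y)`. -/
def rowEnc {n N : ℕ} (j : ℤ) (y : Fin n → ZMod N) : Row :=
  (if j < 0 then {(0, 0)} else ∅) ∪ (bits j.natAbs).image (fun i => (1, i)) ∪
    Finset.univ.biUnion fun a : Fin n => (bits (y a).val).image fun i => (2 + (a : ℕ), i)

theorem mem_rowEnc {n N : ℕ} {j : ℤ} {y : Fin n → ZMod N} {a i : ℕ} :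
    (a, i) ∈ rowEnc j y ↔ (a = 0 ∧ i = 0 ∧ j < 0) ∨ (a = 1 ∧ j.natAbs.testBit i = true) ∨
      ∃ a' : Fin n, a = 2 + (a' : ℕ) ∧ (y a').val.testBit i = true := by
  have h0 : (a, i) ∈ (if j < 0 then {(0, 0)} else ∅ : Row) ↔ a = 0 ∧ i = 0 ∧ j < 0 := by
    split_ifs with h <;> simp [h]
  simp only [rowEnc, Finset.mem_union, h0, Finset.mem_image, Finset.mem_biUnion, Finset.mem_univ,
    true_and, mem_bits, Prod.mk.injEq, or_assoc]
  refine or_congr_right (or_congr ⟨?_, ?_⟩ (exists_congr fun a' => ⟨?_, ?_⟩))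
  · rintro ⟨i', h, rfl, rfl⟩; exact ⟨rfl, h⟩
  · rintro ⟨rfl, h⟩; exact ⟨i, h, rfl, rfl⟩
  · rintro ⟨i', h, rfl, rfl⟩; exact ⟨rfl, h⟩
  · rintro ⟨rfl, h⟩; exact ⟨i, h, rfl, rfl⟩

theorem rowEnc_injective {n N : ℕ} (y : ℤ → Fin n → ZMod N) :
    Function.Injective fun j : ℤ => rowEnc j (y j) := by
  intro j j' h
  have hs : ∀ j : ℤ, ∀ y : Fin n → ZMod N, (0, 0) ∈ rowEnc j y ↔ j < 0 := by
    intro j y; rw [mem_rowEnc]; simp; omega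
  have hm : ∀ j : ℤ, ∀ y : Fin n → ZMod N, ∀ i,
      (1, i) ∈ rowEnc j y ↔ j.natAbs.testBit i = true := by
    intro j y i
    rw [mem_rowEnc]
    constructor
    · rintro (h | h | ⟨a, h, _⟩)
      · omega
      · exact h.2
      · omega
    · intro h; exact Or.inr (Or.inl ⟨rfl, h⟩)
  simp only at h
  have h1 : j < 0 ↔ j' < 0 := by rw [← hs j (y j), h, hs]
  have h2 : j.natAbs = j'.natAbs := by
    apply Nat.eq_of_testBit_eq
    intro i
    rw [Bool.eq_iff_iff, ← hm j (y j), h, hm]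
  omega

theorem mem_encode {n N ℓ : ℕ} {j : Fin ℓ → ℤ} {y : Fin ℓ → Fin n → ZMod N} {q : Qubit} :
    q ∈ encode j y ↔ ∃ k : Fin ℓ, q.2.1 = k ∧ (q.1, q.2.2) ∈ rowEnc (j k) (y k) := by
  obtain ⟨a, k', i⟩ := q
  have h0 : ∀ k : Fin ℓ, (a, k', i) ∈ (if j k < 0 then {(0, (k : ℕ), 0)} else ∅ : Finset Qubit) ↔
      k' = k ∧ a = 0 ∧ i = 0 ∧ j k < 0 := by
    intro k
    split_ifs with h <;> simp [h]
    tauto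
  simp only [encode, Finset.mem_biUnion, Finset.mem_univ, true_and, Finset.mem_union, h0,
    Finset.mem_image, mem_bits, Prod.mk.injEq, mem_rowEnc]
  refine exists_congr fun k => ?_
  constructor
  · rintro ((⟨h1, h2⟩ | ⟨i', h, h1, h2, h3⟩) | ⟨a', i', h, h1, h2, h3⟩)
    · exact ⟨h1, Or.inl h2⟩
    · subst h3; exact ⟨h2.symm, Or.inr (Or.inl ⟨h1.symm, h⟩)⟩
    · subst h3; exact ⟨h2.symm, Or.inr (Or.inr ⟨a', h1.symm, h⟩)⟩
  · rintro ⟨h1, h2 | ⟨h2, h3⟩ | ⟨a', h2, h3⟩⟩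
    · exact Or.inl (Or.inl ⟨h1, h2⟩)
    · exact Or.inl (Or.inr ⟨i, h3, h2.symm, h1.symm, rfl⟩)
    · exact Or.inr ⟨a', i, h3, h2.symm, h1.symm, rfl⟩

theorem row_encode {n N ℓ : ℕ} (j : Fin ℓ → ℤ) (y : Fin ℓ → Fin n → ZMod N) (k : Fin ℓ) :
    row (encode j y) k = rowEnc (j k) (y k) := by
  ext ⟨a, i⟩
  rw [mem_row, mem_encode]
  constructor
  · rintro ⟨k', h, h'⟩
    obtain rfl : k = k' := Fin.ext h
    exact h'
  · intro h; exact ⟨k, rfl, h⟩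

theorem row_eq_empty {b : Finset Qubit} {ℓ k : ℕ} (hb : ∀ q ∈ b, q.2.1 < ℓ) (hk : ℓ ≤ k) :
    row b k = ∅ := by
  ext ⟨a, i⟩
  rw [mem_row]
  simp only [Finset.notMem_empty, iff_false]
  intro h
  exact absurd (hb _ h) (by simpa using hk)

/-- Amplitudes of a single state of an instance. -/
def rowAmp {n N : ℕ} (f : ℤ → ℂ) (s x : Fin n → ZMod N) : Row → ℂ :=
  Function.extend (fun j : ℤ => rowEnc j fun a => x a + (j : ZMod N) * s a) (amplitude f) 0

theorem rowAmp_rowEnc {n N : ℕ} (f : ℤ → ℂ) (s x : Fin n → ZMod N) (j : ℤ) :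
    rowAmp f s x (rowEnc j fun a => x a + (j : ZMod N) * s a) = amplitude f j :=
  (rowEnc_injective fun (j : ℤ) a => x a + (j : ZMod N) * s a).extend_apply _ _ j

theorem exists_of_rowAmp_ne_zero {n N : ℕ} {f : ℤ → ℂ} {s x : Fin n → ZMod N} {A : Row}
    (h : rowAmp f s x A ≠ 0) : ∃ j : ℤ, rowEnc j (fun a => x a + (j : ZMod N) * s a) = A := by
  by_contra hA
  exact h (by rw [rowAmp, Function.extend_apply' _ _ _ hA]; rfl)

/-- Distinct rows occupy distinct qubits and a row's content determines its `j`, so the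
superposition factorises. -/
theorem edcpState_eq_prodState {n N ℓ : ℕ} (f : ℤ → ℂ) (s : Fin n → ZMod N)
    (x : Fin ℓ → Fin n → ZMod N) :
    edcpState f s x = prodState fun k => rowAmp f s (x k) := by
  funext b
  by_cases hb : ∃ j : Fin ℓ → ℤ, encode j (fun k a => x k a + (j k : ZMod N) * s a) = b
  · obtain ⟨j, rfl⟩ := hb
    rw [edcpState, (encode_injective s x).extend_apply, prodState, if_pos]
    · exact Finset.prod_congr rfl fun k _ => by rw [row_encode, rowAmp_rowEnc]
    · intro q hq
      obtain ⟨k, hk, _⟩ := mem_encode.1 hq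
      rw [hk]; exact k.2
  · rw [edcpState, Function.extend_apply' _ _ _ hb, prodState]
    split_ifs with h
    · symm
      by_contra hne
      have := fun k => exists_of_rowAmp_ne_zero (Finset.prod_ne_zero_iff.1 hne k (Finset.mem_univ k))
      choose j hj using this
      refine hb ⟨j, row_ext fun k => ?_⟩
      rcases lt_or_ge k ℓ with hk | hk
      · exact (row_encode _ _ ⟨k, hk⟩).trans (hj ⟨k, hk⟩)
      · rw [row_eq_empty h hk]
        refine row_eq_empty (ℓ := ℓ) (fun q hq => ?_) hk
        obtain ⟨k, hk, _⟩ := mem_encode.1 hq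
        rw [hk]; exact k.2
    · rfl

theorem lt_clog_of_testBit {m M i : ℕ} (hm : m < M) (h : m.testBit i = true) :
    i < Nat.clog 2 M := by
  have h1 := Nat.ge_two_pow_of_testBit h
  have h2 := Nat.le_pow_clog one_lt_two M
  exact (Nat.pow_lt_pow_iff_right one_lt_two).1 (h1.trans_lt (hm.trans_le h2))

theorem rowEnc_subset_lowSet {n N M : ℕ} [NeZero N] {j : ℤ} (h0 : 0 ≤ j) (hM : j.natAbs < M)
    (y : Fin n → ZMod N) : ∀ w ∈ rowEnc j y, w ∈ lowSet n N M := by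
  rintro ⟨a, i⟩ hw
  rcases mem_rowEnc.1 hw with h | ⟨rfl, h⟩ | ⟨a', rfl, h⟩
  · omega
  · exact Or.inl ⟨rfl, lt_clog_of_testBit hM h⟩
  · exact Or.inr ⟨by simp, by simp, lt_clog_of_testBit (ZMod.val_lt _) h⟩

theorem rowAmp_uniform_low {n N M : ℕ} [NeZero N] {s x : Fin n → ZMod N} {A : Row}
    (h : rowAmp (uniformWeight M) s x A ≠ 0) : ∀ w ∈ A, w ∈ lowSet n N M := by
  obtain ⟨j, rfl⟩ := exists_of_rowAmp_ne_zero h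
  rw [rowAmp_rowEnc, amplitude, uniformWeight] at h
  have hj : 0 ≤ j ∧ j < M := by
    by_contra hj
    simp [hj] at h
  exact rowEnc_subset_lowSet hj.1 (by omega) _

/-! ### The solver on product states -/

theorem Wire.address_mem_lowSet {n N M ℓ : ℕ} (w : Wire n N M ℓ) :
    (w.address.1, w.address.2.2) ∈ lowSet n N M := by
  rcases w with ⟨t, i | ⟨a, b⟩⟩
  · exact Or.inl ⟨rfl, i.2⟩
  · exact Or.inr ⟨by simp [address], by simp [address], b.2⟩

theorem Wire.address_row {n N M ℓ : ℕ} (w : Wire n N M ℓ) : w.address.2.1 = w.1 := by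
  rcases w with ⟨t, i | ⟨a, b⟩⟩ <;> rfl

theorem Wire.exists_address {n N M ℓ : ℕ} {a i : ℕ} (h : (a, i) ∈ lowSet n N M) (t : Fin ℓ) :
    ∃ w : Wire n N M ℓ, w.address = (a, (t : ℕ), i) := by
  rcases h with ⟨rfl, h⟩ | ⟨h1, h2, h3⟩
  · exact ⟨(t, Sum.inl ⟨i, h⟩), rfl⟩
  · simp only at h1 h2 h3
    refine ⟨(t, Sum.inr (⟨a - 2, by omega⟩, ⟨i, h3⟩)), ?_⟩
    simp only [address, Prod.mk.injEq, and_true]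
    omega

open scoped Matrix in
/-- The probability that the solver outputs `s` in the state `φ` of its qubits. -/
def Solver.value {n N M ℓ : ℕ} (O : Solver n N M ℓ) (s : Fin n → ZMod N)
    (φ : Finset (Wire n N M ℓ) → ℂ) : ℝ≥0∞ :=
  ENNReal.ofReal (star φ ⬝ᵥ (O.effect s *ᵥ φ)).re

theorem Solver.value_zero {n N M ℓ : ℕ} (O : Solver n N M ℓ) (s : Fin n → ZMod N) :
    O.value s (fun _ => 0) = 0 := by
  have : (fun _ => 0 : Finset (Wire n N M ℓ) → ℂ) = 0 := rfl
  simp [value, this]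

open scoped Matrix in
theorem Solver.value_mul {n N M ℓ : ℕ} (O : Solver n N M ℓ) (s : Fin n → ZMod N) (c : ℂ)
    (φ : Finset (Wire n N M ℓ) → ℂ) :
    O.value s (fun v => c * φ v) = ENNReal.ofReal (‖c‖ ^ 2) * O.value s φ := by
  have h : (fun v => c * φ v) = c • φ := rfl
  have h2 : star c * c = ((‖c‖ ^ 2 : ℝ) : ℂ) := by
    rw [Complex.star_def, Complex.conj_mul']; norm_cast
  rw [value, value, ← ENNReal.ofReal_mul (by positivity), h, Matrix.mulVec_smul, star_smul,
    smul_dotProduct, dotProduct_smul, smul_smul, h2, smul_eq_mul, Complex.re_ofReal_mul]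

/-- A uniform instance is supported on the solver's own qubits, so only the empty content of the
others contributes. -/
theorem Solver.prob_uniform {n N M ℓ : ℕ} [NeZero N] (O : Solver n N M ℓ) (s : Fin n → ZMod N)
    (x : Fin ℓ → Fin n → ZMod N) :
    O.prob s (edcpState (uniformWeight M) s x) =
      O.value s fun v => edcpState (uniformWeight M) s x (v.image Wire.address) := by
  rw [prob, tsum_eq_single ⟨∅, by simp⟩]
  · simp only [Finset.empty_union]; rfl
  · rintro ⟨R, hR⟩ hne
    have hR' : R.Nonempty := Finset.nonempty_iff_ne_empty.2 fun h => hne (Subtype.ext h)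
    obtain ⟨⟨a, k, i⟩, hq⟩ := hR'
    rw [← O.value_zero s]
    refine congrArg (O.value s) (funext fun v => ?_)
    rw [edcpState_eq_prodState, prodState]
    split_ifs with h
    · have hk : k < ℓ := h (a, k, i) (Finset.mem_union_left _ hq)
      refine Finset.prod_eq_zero (Finset.mem_univ ⟨k, hk⟩) ?_
      by_contra hA
      have := rowAmp_uniform_low hA (a, i) (mem_row.2 (Finset.mem_union_left _ hq))
      obtain ⟨w, hw⟩ := Wire.exists_address this ⟨k, hk⟩
      exact hR w (hw ▸ hq)
    · rfl

/-- Distributivity of a finite product over infinite sums, needing no convergence hypotheses in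
`ℝ≥0∞`; induction adds one factor at a time. -/
theorem prod_tsum {ι α : Type} [Fintype ι] (F : ι → α → ℝ≥0∞) :
    ∏ k, ∑' A, F k A = ∑' g : ι → α, ∏ k, F k (g k) := by
  classical
  revert F
  refine Fintype.induction_empty_option (P := fun ι _ => ∀ F : ι → α → ℝ≥0∞,
    ∏ k, ∑' A, F k A = ∑' g : ι → α, ∏ k, F k (g k)) ?_ ?_ ?_ ι
  · intro ι ι' _ e ih F
    let _ := Fintype.ofEquiv ι' e.symm
    rw [← e.prod_comp, ih, ← (Equiv.arrowCongr e (Equiv.refl α)).tsum_eq]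
    refine tsum_congr fun g => ?_
    rw [← e.prod_comp]
    simp
  · intro F; simp
  · intro ι _ ih F
    rw [Fintype.prod_option, ih, ← (Equiv.piOptionEquivProd (β := fun _ => α)).symm.tsum_eq,
      ENNReal.tsum_prod', ← ENNReal.tsum_mul_right]
    refine tsum_congr fun a => ?_
    rw [← ENNReal.tsum_mul_left]
    refine tsum_congr fun g => ?_
    rw [Fintype.prod_option]
    rfl

theorem prod_subtype_range {ι κ α : Type*} [Fintype ι] [CommMonoid α] {g : ι → κ}
    {_ : Fintype {k // k ∈ Set.range g}} (hg : Function.Injective g) (F : κ → α) :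
    ∏ k : {k // k ∈ Set.range g}, F k = ∏ t, F (g t) :=
  (Fintype.prod_equiv (Equiv.ofInjective g hg) _ _ fun _ => rfl).symm

/-- The rows `κs t` are in uniform states up to the factor `β`, and the permutation `τ` of the qubits
brings them to the rows `t` that the solver uses. -/
theorem Solver.le_prob_permute {n N M ℓ ℓ' : ℕ} [NeZero N] (O : Solver n N M ℓ')
    (s : Fin n → ZMod N) (x : Fin ℓ → Fin n → ZMod N) (f : Fin ℓ → Row → ℂ)
    (τ : Equiv.Perm Qubit) (κs : Fin ℓ' → Fin ℓ) (hκ : Function.Injective κs) (β : ℝ)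
    (hτ : ∀ w : Wire n N M ℓ', τ w.address = (w.address.1, (κs w.1 : ℕ), w.address.2.2))
    (hf : ∀ t, ∀ A : Row, (∀ w ∈ A, w ∈ lowSet n N M) →
      f (κs t) A = β * rowAmp (uniformWeight M) s (x (κs t)) A) :
    open Classical in
    ENNReal.ofReal (β ^ 2) ^ ℓ' *
        (∏ k : {k : Fin ℓ // ¬ k ∈ Set.range κs}, ∑' A, ENNReal.ofReal (‖f k A‖ ^ 2)) *
        O.prob s (edcpState (uniformWeight M) s fun t => x (κs t)) ≤
      O.prob s (permute τ (prodState f)) := by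
  classical
  let ι := {k : Fin ℓ // ¬ k ∈ Set.range κs}
  let total : (ι → Row) → Finset Qubit := fun g =>
    Finset.univ.biUnion fun k : ι => (g k).image fun w => (w.1, ((k : Fin ℓ) : ℕ), w.2)
  have mem_total : ∀ g a j i, (a, j, i) ∈ total g ↔
      ∃ k : ι, ((k : Fin ℓ) : ℕ) = j ∧ (a, i) ∈ g k := by
    intro g a j i
    simp only [total, Finset.mem_biUnion, Finset.mem_univ, true_and, Finset.mem_image,
      Prod.mk.injEq, Prod.exists]
    refine exists_congr fun k => ⟨?_, ?_⟩
    · rintro ⟨a', i', h, rfl, h2, rfl⟩; exact ⟨h2, h⟩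
    · rintro ⟨h2, h⟩; exact ⟨a, i, h, rfl, h2, rfl⟩
  have row_total : ∀ g (k : ι), row (total g) ((k : Fin ℓ) : ℕ) = g k := by
    intro g k
    ext ⟨a, i⟩
    rw [mem_row, mem_total]
    constructor
    · rintro ⟨k', h, h'⟩
      obtain rfl : k' = k := Subtype.ext (Fin.ext h)
      exact h'
    · intro h; exact ⟨k, rfl, h⟩
  have total_range : ∀ g t a i, (a, ((κs t : Fin ℓ) : ℕ), i) ∉ total g := by
    intro g t a i h
    obtain ⟨k, hk, _⟩ := (mem_total _ _ _ _).1 h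
    exact k.2 ⟨t, (Fin.ext hk).symm⟩
  -- A choice of contents for the unused rows, with nothing else set outside the solver's qubits,
  -- pulled back through `τ`.
  let R : (ι → Row) → {R : Finset Qubit // ∀ w : Wire n N M ℓ', w.address ∉ R} := fun g =>
    ⟨(total g).map τ.symm.toEmbedding, fun w hw => by
      rw [Finset.mem_map_equiv, Equiv.symm_symm, hτ] at hw
      exact total_range _ _ _ _ hw⟩
  have hR : Function.Injective R := by
    intro g g' h
    have h1 : total g = total g' := Finset.map_injective _ (congrArg Subtype.val h)
    funext k
    rw [← row_total g k, h1, row_total]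
  -- For such a content, the solver's qubits are in the ideal uniform state up to a scalar.
  have hval : ∀ (g : ι → Row) (v : Finset (Wire n N M ℓ')), permute τ (prodState f) ((R g).1 ∪ v.image Wire.address) =
      ((∏ k : ι, f k (g k)) * (β : ℂ) ^ ℓ') *
        edcpState (uniformWeight M) s (fun t => x (κs t)) (v.image Wire.address) := by
    intro g v
    have hmap : ((R g).1 ∪ v.image Wire.address).map τ.toEmbedding =
        total g ∪ (v.image Wire.address).map τ.toEmbedding := by
      rw [Finset.map_union]
      congr 1
      ext q
      simp [R, Finset.mem_map_equiv]
    have hmem : ∀ a j i, (a, j, i) ∈ (v.image Wire.address).map τ.toEmbedding ↔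
        ∃ w ∈ v, a = w.address.1 ∧ j = κs w.1 ∧ i = w.address.2.2 := by
      intro a j i
      simp only [Finset.mem_map, Finset.mem_image, Equiv.coe_toEmbedding, exists_exists_and_eq_and,
        hτ, Prod.mk.injEq]
      refine exists_congr fun w => and_congr_right fun _ => ?_
      rw [eq_comm (a := a), eq_comm (a := j), eq_comm (a := i)]
    have hlt : ∀ q ∈ total g ∪ (v.image Wire.address).map τ.toEmbedding, q.2.1 < ℓ := by
      rintro ⟨a, j, i⟩ hq
      rcases Finset.mem_union.1 hq with hq | hq
      · obtain ⟨k, hk, _⟩ := (mem_total _ _ _ _).1 hq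
        simp only [← hk]; exact k.1.2
      · obtain ⟨w, _, _, hk, _⟩ := (hmem _ _ _).1 hq
        simp only [hk]; exact (κs w.1).2
    have hlt' : ∀ q ∈ v.image Wire.address, q.2.1 < ℓ' := by
      intro q hq
      obtain ⟨w, _, rfl⟩ := Finset.mem_image.1 hq
      rw [Wire.address_row]; exact w.1.2
    have hrow1 : ∀ k : ι, row (total g ∪ (v.image Wire.address).map τ.toEmbedding)
        ((k : Fin ℓ) : ℕ) = g k := by
      intro k
      rw [← row_total g k]
      ext ⟨a, i⟩
      rw [mem_row, mem_row, Finset.mem_union, or_iff_left]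
      rw [hmem]
      rintro ⟨w, _, _, hk, _⟩
      exact k.2 ⟨w.1, (Fin.ext hk).symm⟩
    have hrow2 : ∀ t, row (total g ∪ (v.image Wire.address).map τ.toEmbedding)
        ((κs t : Fin ℓ) : ℕ) = row (v.image Wire.address) t := by
      intro t
      ext ⟨a, i⟩
      rw [mem_row, mem_row, Finset.mem_union, or_iff_right (total_range _ _ _ _), hmem,
        Finset.mem_image]
      refine exists_congr fun w => and_congr_right fun _ => ?_
      constructor
      · rintro ⟨h1, h2, h3⟩
        have : t = w.1 := hκ (Fin.ext h2)
        ext <;> simp [h1, h3, Wire.address_row, this]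
      · intro h
        refine ⟨by rw [h], ?_, by rw [h]⟩
        have h4 := Wire.address_row w
        rw [h] at h4
        rw [Fin.ext h4]
    have hlow : ∀ t : Fin ℓ', ∀ w ∈ row (v.image Wire.address) (t : ℕ), w ∈ lowSet n N M := by
      rintro t ⟨a, i⟩ hw
      rw [mem_row, Finset.mem_image] at hw
      obtain ⟨w, _, hw⟩ := hw
      have := Wire.address_mem_lowSet w
      rwa [hw] at this
    rw [permute, hmap, prodState, if_pos hlt, edcpState_eq_prodState, prodState, if_pos hlt',
      ← Fintype.prod_subtype_mul_prod_subtype (fun k => k ∈ Set.range κs), mul_comm, mul_assoc]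
    congr 1
    · exact Finset.prod_congr rfl fun k _ => by rw [hrow1 k]
    · refine (prod_subtype_range hκ
        fun k => f k (row (total g ∪ (v.image Wire.address).map τ.toEmbedding) k)).trans ?_
      simp only [hrow2]
      rw [← Fin.prod_const, ← Finset.prod_mul_distrib]
      exact Finset.prod_congr rfl fun t _ => hf t _ (hlow t)
  calc _ = ∑' g : ι → Row, ENNReal.ofReal (‖(∏ k : ι, f k (g k)) * (β : ℂ) ^ ℓ'‖ ^ 2) *
        O.prob s (edcpState (uniformWeight M) s fun t => x (κs t)) := by
        rw [prod_tsum, ENNReal.tsum_mul_right, ← ENNReal.tsum_mul_left]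
        congr 1
        refine tsum_congr fun g => ?_
        rw [← ENNReal.ofReal_pow (by positivity), ← ENNReal.ofReal_prod_of_nonneg
          (fun _ _ => by positivity), ← ENNReal.ofReal_mul (by positivity)]
        congr 1
        rw [norm_mul, norm_prod, norm_pow, Complex.norm_real, mul_pow, Finset.prod_pow,
          ← pow_mul, ← pow_mul, mul_comm ℓ' 2, pow_mul ‖β‖, Real.norm_eq_abs, sq_abs, ← pow_mul]
        ring
    _ = ∑' g : ι → Row, O.value s fun v =>
          permute τ (prodState f) ((R g).1 ∪ v.image Wire.address) := by
        refine tsum_congr fun g => ?_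
        simp only [hval]
        rw [Solver.value_mul, Solver.prob_uniform]
    -- All other contents are dropped; among them are those where a used row carries an undetected
    -- high bit.
    _ ≤ _ := ENNReal.tsum_comp_le_tsum_of_injective hR
        (fun R => O.value s fun v => permute τ (prodState f) (R.1 ∪ v.image Wire.address))

/-! ### Binary expansions -/

theorem mod_two_pow_succ_eq (x i : ℕ) :
    x % 2 ^ (i + 1) = x % 2 ^ i + if x.testBit i then 2 ^ i else 0 := by
  rw [Nat.mod_pow_succ, Nat.testBit_eq_decide_div_mod_eq]
  rcases Nat.mod_two_eq_zero_or_one (x / 2 ^ i) with h | h <;> simp [h]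

theorem sum_testBit (x B : ℕ) :
    ∑ i ∈ Finset.range B, (if x.testBit i then (2 : ℝ) ^ i else 0) = (x % 2 ^ B : ℕ) := by
  induction B with
  | zero => simp [Nat.mod_one]
  | succ B ih =>
    rw [Finset.sum_range_succ, ih, mod_two_pow_succ_eq]
    split_ifs <;> simp

theorem one_mem_rowEnc {n N : ℕ} {j : ℤ} {y : Fin n → ZMod N} {i : ℕ} :
    (1, i) ∈ rowEnc j y ↔ j.natAbs.testBit i = true := by
  rw [mem_rowEnc]
  constructor
  · rintro (h | h | ⟨a, h, _⟩)
    · omega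
    · exact h.2
    · omega
  · intro h; exact Or.inr (Or.inl ⟨rfl, h⟩)

theorem zero_mem_rowEnc {n N : ℕ} {j : ℤ} {y : Fin n → ZMod N} {i : ℕ} :
    (0, i) ∈ rowEnc j y ↔ i = 0 ∧ j < 0 := by
  rw [mem_rowEnc]
  constructor
  · rintro (h | h | ⟨a, h, _⟩)
    · exact h.2
    · omega
    · omega
  · intro h; exact Or.inl ⟨rfl, h⟩

theorem rowGt_rowEnc {n N : ℕ} (m : ℕ) (j : ℤ) (y : Fin n → ZMod N) (i : ℕ) :
    RowGt m (rowEnc j y) i ↔ m % 2 ^ i < j.natAbs % 2 ^ i := by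
  induction i with
  | zero => simp [RowGt, Nat.mod_one]
  | succ i ih =>
    have h1 := Nat.mod_lt m (Nat.two_pow_pos i)
    have h2 := Nat.mod_lt j.natAbs (Nat.two_pow_pos i)
    simp only [RowGt, ih, one_mem_rowEnc, mod_two_pow_succ_eq]
    by_cases hm : m.testBit i <;> by_cases hj : j.natAbs.testBit i <;> simp [hm, hj] <;> omega

/-- The product of the factors of all pairs of bits. -/
theorem prod_damp {n N : ℕ} (r : ℝ) (j : ℤ) (y : Fin n → ZMod N) (B : ℕ) :
    (∏ a ∈ Finset.range B, ∏ b ∈ Finset.range B,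
      if (1, a) ∈ rowEnc j y ∧ (1, b) ∈ rowEnc j y then 1 else
        Real.exp (-(Real.pi * (2 ^ a * 2 ^ b)) / (r * r))) =
    Real.exp (-(Real.pi / (r * r)) * ((2 ^ B - 1) ^ 2 - ((j.natAbs % 2 ^ B : ℕ) : ℝ) ^ 2)) := by
  -- `t i` is the contribution of bit `i`, so the square of the number is the double sum of the `t a
  -- * t b`.
  let t : ℕ → ℝ := fun i => if j.natAbs.testBit i then (2 : ℝ) ^ i else 0
  have h : ∀ a b, (if (1, a) ∈ rowEnc j y ∧ (1, b) ∈ rowEnc j y then 1 else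
        Real.exp (-(Real.pi * (2 ^ a * 2 ^ b)) / (r * r))) =
      Real.exp (-(Real.pi / (r * r)) * (2 ^ a * 2 ^ b - t a * t b)) := by
    intro a b
    simp only [one_mem_rowEnc, t]
    by_cases ha : j.natAbs.testBit a <;> by_cases hb : j.natAbs.testBit b <;> simp [ha, hb] <;> ring
  have hg : ∑ i ∈ Finset.range B, (2 : ℝ) ^ i = 2 ^ B - 1 := by
    rw [geom_sum_eq (by norm_num)]; norm_num
  simp only [h, ← Real.exp_sum, ← Finset.mul_sum, Finset.sum_sub_distrib]
  simp only [← Finset.sum_mul, hg]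
  rw [show ∑ i ∈ Finset.range B, t i = ((j.natAbs % 2 ^ B : ℕ) : ℝ) from sum_testBit _ _]
  congr 1; ring

/-! ### Gaussian sums -/

theorem norm_gaussianWeight_sq (r : ℝ) (j : ℤ) :
    ‖gaussianWeight r j‖ ^ 2 = Real.exp (-(2 * Real.pi / r ^ 2) * (j : ℝ) ^ 2) := by
  rw [gaussianWeight, Complex.norm_real, Real.norm_of_nonneg (Real.exp_pos _).le, ← Real.exp_nat_mul]
  congr 1; push_cast; ring

/-- The squared norm of the Gaussian weights. -/
def gaussianSum (r : ℝ) : ℝ := ∑' i : ℤ, ‖gaussianWeight r i‖ ^ 2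

/-- From (n - r)² ≥ 0, that is n² ≥ 2rn - r²: the Gaussian lies below a geometric sequence whose sum
is O(1 + r). -/
theorem gaussian_nat_le {r : ℝ} (hr : 0 < r) (n : ℕ) :
    Real.exp (-(2 * Real.pi / r ^ 2) * (n : ℝ) ^ 2) ≤
      Real.exp (2 * Real.pi) * Real.exp (-(4 * Real.pi / r)) ^ n := by
  rw [← Real.exp_nat_mul, ← Real.exp_add, Real.exp_le_exp]
  have h : 0 ≤ 2 * Real.pi / r ^ 2 * ((n : ℝ) - r) ^ 2 := by positivity
  have e : 2 * Real.pi / r ^ 2 * ((n : ℝ) - r) ^ 2 =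
      2 * Real.pi / r ^ 2 * (n : ℝ) ^ 2 - 4 * Real.pi / r * n + 2 * Real.pi := by
    field_simp; ring
  linarith

theorem one_sub_exp_inv_le {x : ℝ} (hx : 0 < x) : (1 - Real.exp (-x))⁻¹ ≤ 1 + 1 / x := by
  have h1 : 1 + x ≤ Real.exp x := by linarith [Real.add_one_le_exp x]
  have h2 : Real.exp (-x) ≤ 1 / (1 + x) := by
    rw [Real.exp_neg, one_div]
    exact inv_anti₀ (by positivity) h1
  have h3 : x / (1 + x) ≤ 1 - Real.exp (-x) := by
    have : x / (1 + x) = 1 - 1 / (1 + x) := by field_simp; ring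
    linarith
  calc (1 - Real.exp (-x))⁻¹ ≤ (x / (1 + x))⁻¹ := inv_anti₀ (by positivity) h3
    _ = 1 + 1 / x := by field_simp; ring

theorem gaussian_hasSum_nat {r : ℝ} (hr : 0 < r) :
    Summable (fun n : ℕ => Real.exp (-(2 * Real.pi / r ^ 2) * (n : ℝ) ^ 2)) ∧
    ∑' n : ℕ, Real.exp (-(2 * Real.pi / r ^ 2) * (n : ℝ) ^ 2) ≤
      Real.exp (2 * Real.pi) * (1 + r / (4 * Real.pi)) := by
  have hx : 0 < 4 * Real.pi / r := by positivity
  have hlt : Real.exp (-(4 * Real.pi / r)) < 1 := by rw [Real.exp_lt_one_iff]; linarith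
  have hs : Summable fun n : ℕ => Real.exp (2 * Real.pi) * Real.exp (-(4 * Real.pi / r)) ^ n :=
    (summable_geometric_of_lt_one (Real.exp_pos _).le hlt).mul_left _
  have hs' : Summable (fun n : ℕ => Real.exp (-(2 * Real.pi / r ^ 2) * (n : ℝ) ^ 2)) :=
    hs.of_nonneg_of_le (fun _ => (Real.exp_pos _).le) (gaussian_nat_le hr)
  refine ⟨hs', (hs'.tsum_le_tsum (gaussian_nat_le hr) hs).trans ?_⟩
  rw [tsum_mul_left, tsum_geometric_of_lt_one (Real.exp_pos _).le hlt]
  refine mul_le_mul_of_nonneg_left ((one_sub_exp_inv_le hx).trans (le_of_eq ?_)) (Real.exp_pos _).le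
  rw [one_div_div]

/-- The term at 0 is 1. The negative half, shifted by one, is dominated by the nonnegative half,
hence the factor 2. -/
theorem gaussianSum_spec {r : ℝ} (hr : 0 < r) :
    Summable (fun i : ℤ => ‖gaussianWeight r i‖ ^ 2) ∧ 1 ≤ gaussianSum r ∧
      gaussianSum r ≤ 2 * (Real.exp (2 * Real.pi) * (1 + r / (4 * Real.pi))) := by
  obtain ⟨hs, hle⟩ := gaussian_hasSum_nat hr
  have h1 : Summable (fun n : ℕ => ‖gaussianWeight r (n : ℤ)‖ ^ 2) := by
    simpa only [norm_gaussianWeight_sq, Int.cast_natCast] using hs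
  have hle2 : ∀ n : ℕ, ‖gaussianWeight r (-((n : ℤ) + 1))‖ ^ 2 ≤ ‖gaussianWeight r (n : ℤ)‖ ^ 2 := by
    intro n
    rw [norm_gaussianWeight_sq, norm_gaussianWeight_sq, Real.exp_le_exp]
    push_cast
    have : 0 ≤ 2 * Real.pi / r ^ 2 * (2 * n + 1) := by positivity
    nlinarith
  have h2 : Summable (fun n : ℕ => ‖gaussianWeight r (-((n : ℤ) + 1))‖ ^ 2) :=
    h1.of_nonneg_of_le (fun _ => by positivity) hle2
  have hsum := HasSum.of_nat_of_neg_add_one (f := fun i : ℤ => ‖gaussianWeight r i‖ ^ 2)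
    h1.hasSum h2.hasSum
  refine ⟨hsum.summable, ?_, ?_⟩
  · have := hsum.summable.le_tsum 0 fun _ _ => by positivity
    refine le_trans (le_of_eq ?_) this
    rw [norm_gaussianWeight_sq]; simp
  · rw [gaussianSum, hsum.tsum_eq]
    have h3 := h2.tsum_le_tsum hle2 h1
    simp only [norm_gaussianWeight_sq (r := r), Int.cast_natCast] at h3 hle ⊢
    linarith

theorem norm_amplitude_gaussian_sq {r : ℝ} (hr : 0 < r) (j : ℤ) :
    ‖amplitude (gaussianWeight r) j‖ ^ 2 =
      Real.exp (-(2 * Real.pi / r ^ 2) * (j : ℝ) ^ 2) / gaussianSum r := by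
  have h := (gaussianSum_spec hr).2.1
  rw [amplitude, norm_div, div_pow, norm_gaussianWeight_sq, Complex.norm_real, Real.norm_eq_abs,
    sq_abs, Real.sq_sqrt]
  · rfl
  · exact zero_le_one.trans h

theorem tsum_amplitude {f : ℤ → ℂ} (hs : Summable fun i => ‖f i‖ ^ 2)
    (h0 : 0 < ∑' i, ‖f i‖ ^ 2) : ∑' j, ENNReal.ofReal (‖amplitude f j‖ ^ 2) = 1 := by
  have h : ∀ j, ‖amplitude f j‖ ^ 2 = ‖f j‖ ^ 2 / ∑' i, ‖f i‖ ^ 2 := by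
    intro j
    rw [amplitude, norm_div, div_pow, Complex.norm_real, Real.norm_eq_abs, sq_abs,
      Real.sq_sqrt h0.le]
  simp only [h]
  rw [← ENNReal.ofReal_tsum_of_nonneg (fun _ => by positivity) (hs.div_const _), tsum_div_const,
    div_self h0.ne', ENNReal.ofReal_one]

theorem uniform_hasSum (M : ℕ) : HasSum (fun i => ‖uniformWeight M i‖ ^ 2) (M : ℝ) := by
  have h : ∀ i ∉ Finset.Ico (0 : ℤ) M, ‖uniformWeight M i‖ ^ 2 = 0 := by
    intro i hi
    rw [Finset.mem_Ico] at hi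
    simp [uniformWeight, hi]
  have : HasSum (fun i : ℤ => ‖uniformWeight M i‖ ^ 2) _ := hasSum_sum_of_ne_finset_zero h
  convert this using 1
  rw [Finset.sum_congr rfl (g := fun _ => (1 : ℝ))]
  · simp
  · intro i hi
    rw [Finset.mem_Ico] at hi
    simp [uniformWeight, hi]

theorem tsum_rowAmp {n N : ℕ} (f : ℤ → ℂ) (s x : Fin n → ZMod N) (F : Row → ℂ → ℝ≥0∞)
    (hF : ∀ A, F A 0 = 0) :
    ∑' A, F A (rowAmp f s x A) =
      ∑' j : ℤ, F (rowEnc j fun a => x a + (j : ZMod N) * s a) (amplitude f j) := by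
  rw [← (rowEnc_injective fun (j : ℤ) a => x a + (j : ZMod N) * s a).tsum_eq]
  · simp only [rowAmp_rowEnc]
  · intro A hA
    have : rowAmp f s x A ≠ 0 := fun h => hA (by simp only [h, hF])
    obtain ⟨j, hj⟩ := exists_of_rowAmp_ne_zero this
    exact ⟨j, hj⟩

/-- For j ≥ L, j² ≥ Lj makes the weight at most exp(-xj). Summing over all j ≥ 1 gives 1/(exp x - 1)
≤ 1/x. Only the positive tail is needed, because negative j are caught by the sign qubit. -/
theorem gaussian_tail_le {r x : ℝ} (hr : 0 < r) (hx : 0 < x) (L : ℕ) (hL : 1 ≤ L)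
    (hxL : x ≤ 2 * Real.pi / r ^ 2 * L) :
    ∑' j : ℤ, (if (L : ℤ) ≤ j then ENNReal.ofReal (‖amplitude (gaussianWeight r) j‖ ^ 2) else 0) ≤
      ENNReal.ofReal (1 / x) := by
  have hlt : Real.exp (-x) < 1 := by rw [Real.exp_lt_one_iff]; linarith
  have hinj : Function.Injective fun n : ℕ => (n : ℤ) + 1 := fun a b h => by simpa using h
  rw [← hinj.tsum_eq]
  · have hs := (summable_geometric_of_lt_one (Real.exp_pos _).le hlt).mul_left (Real.exp (-x))
    calc _ ≤ ∑' n : ℕ, ENNReal.ofReal (Real.exp (-x) * Real.exp (-x) ^ n) := by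
          refine ENNReal.tsum_le_tsum fun n => ?_
          split_ifs with h
          · apply ENNReal.ofReal_le_ofReal
            rw [norm_amplitude_gaussian_sq hr, ← Real.exp_nat_mul, ← Real.exp_add]
            refine (div_le_self (Real.exp_pos _).le (gaussianSum_spec hr).2.1).trans ?_
            rw [Real.exp_le_exp]
            have h' : (L : ℝ) ≤ (n : ℝ) + 1 := by exact_mod_cast h
            have h1 : x * ((n : ℝ) + 1) ≤ 2 * Real.pi / r ^ 2 * L * (n + 1) := by gcongr
            have h2 : 2 * Real.pi / r ^ 2 * L * (n + 1) ≤
                2 * Real.pi / r ^ 2 * ((n : ℝ) + 1) * (n + 1) := by gcongr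
            push_cast
            linarith
          · simp
      _ = ENNReal.ofReal (Real.exp (-x) * (1 - Real.exp (-x))⁻¹) := by
          rw [← ENNReal.ofReal_tsum_of_nonneg (fun _ => by positivity) hs, tsum_mul_left,
            tsum_geometric_of_lt_one (Real.exp_pos _).le hlt]
      _ ≤ _ := by
          apply ENNReal.ofReal_le_ofReal
          have h1 := one_sub_exp_inv_le hx
          have h2 : Real.exp (-x) * (1 - Real.exp (-x))⁻¹ = (1 - Real.exp (-x))⁻¹ - 1 := by
            have : 1 - Real.exp (-x) ≠ 0 := by linarith
            field_simp; ring
          linarith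
  · intro j hj
    have hj' : (L : ℤ) ≤ j := by
      by_contra h; exact hj (by simp [h])
    exact ⟨(j - 1).toNat, by simp only; omega⟩

/-! ### The measurement of one state -/

/-- The factor of the amplitudes in the successful branch. -/
def rowFactor (r : ℝ) (p : Params) (A : Row) : ℝ :=
  open Classical in (if (0, 0) ∈ A then 0 else 1) *
    ((∏ i ∈ Finset.range (Nat.clog 2 p.M + (p.κ + p.ℓ)),
      if (1, Nat.clog 2 p.M + i) ∈ A then 0 else 1) *
    ((∏ a ∈ Finset.range (Nat.clog 2 p.M), ∏ b ∈ Finset.range (Nat.clog 2 p.M),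
      if (1, a) ∈ A ∧ (1, b) ∈ A then 1 else
        Real.exp (-(Real.pi * (2 ^ a * 2 ^ b)) / (r * r))) *
    if RowGt (p.M - 1) A (Nat.clog 2 p.M) then 0 else 1))

/-- The factor between the uniform amplitudes and those in the successful branch. -/
def successFactor (r : ℝ) (M : ℕ) : ℝ :=
  Real.exp (-(Real.pi / r ^ 2) * (2 ^ Nat.clog 2 M - 1) ^ 2) * √M / √(gaussianSum r)

theorem rowFactor_of_lt {n N : ℕ} {r : ℝ} {p : Params} (hM : 1 ≤ p.M) {j : ℤ} (h0 : 0 ≤ j)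
    (hj : j.natAbs < 2 ^ Nat.clog 2 p.M) (y : Fin n → ZMod N) :
    rowFactor r p (rowEnc j y) =
      Real.exp (-(Real.pi / r ^ 2) * ((2 ^ Nat.clog 2 p.M - 1) ^ 2 - (j : ℝ) ^ 2)) *
        if j < p.M then 1 else 0 := by
  have h1 : ∀ i, (1, Nat.clog 2 p.M + i) ∉ rowEnc j y := by
    intro i h
    rw [one_mem_rowEnc] at h
    have := Nat.ge_two_pow_of_testBit h
    have := Nat.pow_le_pow_right two_pos (Nat.le_add_right (Nat.clog 2 p.M) i)
    omega
  have h2 := Nat.le_pow_clog one_lt_two p.M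
  have h3 : (j : ℝ) = (j.natAbs : ℝ) := by
    rw [← Int.cast_natCast, Int.natAbs_of_nonneg h0]
  rw [rowFactor, if_neg (by rw [zero_mem_rowEnc]; omega), prod_damp, rowGt_rowEnc,
    Nat.mod_eq_of_lt hj, Nat.mod_eq_of_lt (show p.M - 1 < 2 ^ Nat.clog 2 p.M by omega), h3]
  simp only [h1, if_false, Finset.prod_const_one, one_mul, ← pow_two]
  congr 1
  by_cases h : j < p.M
  · rw [if_pos h, if_neg (by omega)]
  · rw [if_neg h, if_pos (by omega)]

/-- A content within `lowSet` forces 0 ≤ j < 2^B, with B = `Nat.clog 2 p.M`. There the damping and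
the Gaussian multiply to a constant, and the comparison cuts the support to j < M. -/
theorem rowFactor_mul_rowAmp {n N : ℕ} {r : ℝ} {p : Params} (hM : 1 ≤ p.M)
    (s x : Fin n → ZMod N) {A : Row} (hA : ∀ w ∈ A, w ∈ lowSet n N p.M) :
    (rowFactor r p A : ℂ) * rowAmp (gaussianWeight r) s x A =
      successFactor r p.M * rowAmp (uniformWeight p.M) s x A := by
  by_cases h : ∃ j : ℤ, rowEnc j (fun a => x a + (j : ZMod N) * s a) = A
  · obtain ⟨j, rfl⟩ := h
    have h0 : 0 ≤ j := by
      by_contra h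
      have := hA (0, 0) (zero_mem_rowEnc.2 ⟨rfl, by omega⟩)
      simp [lowSet] at this
    have hj : j.natAbs < 2 ^ Nat.clog 2 p.M := by
      refine Nat.lt_pow_two_of_testBit _ fun i hi => ?_
      by_contra h
      rw [Bool.not_eq_false] at h
      have := hA (1, i) (one_mem_rowEnc.2 h)
      simp [lowSet] at this
      omega
    rw [rowAmp_rowEnc, rowAmp_rowEnc, rowFactor_of_lt hM h0 hj, amplitude, amplitude,
      (uniform_hasSum p.M).tsum_eq, gaussianWeight, uniformWeight, successFactor]
    change _ * (_ / ((√(gaussianSum r) : ℝ) : ℂ)) = _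
    have hsq : √(p.M : ℝ) ≠ 0 := by
      rw [Real.sqrt_ne_zero']; exact_mod_cast hM
    have hexp : Real.exp (-(Real.pi / r ^ 2) * ((2 ^ Nat.clog 2 p.M - 1) ^ 2 - (j : ℝ) ^ 2)) *
        Real.exp (-Real.pi * (j : ℝ) ^ 2 / r ^ 2) =
        Real.exp (-(Real.pi / r ^ 2) * (2 ^ Nat.clog 2 p.M - 1) ^ 2) := by
      rw [← Real.exp_add]; congr 1; ring
    by_cases h : j < p.M
    · simp only [h, h0, and_self, if_true, mul_one]
      rw [← mul_div_assoc, ← Complex.ofReal_mul, hexp]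
      push_cast
      have : ((√(p.M : ℝ) : ℝ) : ℂ) ≠ 0 := by exact_mod_cast hsq
      field_simp
    · simp [h]
  · rw [rowAmp, rowAmp, Function.extend_apply' _ _ _ h, Function.extend_apply' _ _ _ h]
    simp

theorem tsum_rowAmp_gaussian {n N : ℕ} {r : ℝ} (hr : 0 < r) (s x : Fin n → ZMod N) :
    ∑' A, ENNReal.ofReal (‖rowAmp (gaussianWeight r) s x A‖ ^ 2) = 1 := by
  rw [tsum_rowAmp _ _ _ (fun _ z => ENNReal.ofReal (‖z‖ ^ 2)) (by simp)]
  exact tsum_amplitude (gaussianSum_spec hr).1 (zero_lt_one.trans_le (gaussianSum_spec hr).2.1)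

theorem tsum_rowAmp_uniform {n N M : ℕ} (hM : 1 ≤ M) (s x : Fin n → ZMod N) :
    ∑' A, ENNReal.ofReal (‖rowAmp (uniformWeight M) s x A‖ ^ 2) = 1 := by
  rw [tsum_rowAmp _ _ _ (fun _ z => ENNReal.ofReal (‖z‖ ^ 2)) (by simp)]
  refine tsum_amplitude (uniform_hasSum M).summable ?_
  rw [(uniform_hasSum M).tsum_eq]
  exact_mod_cast hM

/-- Contents outside the uniform support are discarded; on it the amplitudes agree up to the factor.
-/
theorem successFactor_sq_le_tsum {n N : ℕ} [NeZero N] {r : ℝ} {p : Params}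
    (hM : 1 ≤ p.M) (s x : Fin n → ZMod N) :
    ENNReal.ofReal (successFactor r p.M ^ 2) ≤
      ∑' A, ENNReal.ofReal (‖(rowFactor r p A : ℂ) * rowAmp (gaussianWeight r) s x A‖ ^ 2) := by
  rw [← mul_one (ENNReal.ofReal _), ← tsum_rowAmp_uniform hM s x, ← ENNReal.tsum_mul_left]
  refine ENNReal.tsum_le_tsum fun A => ?_
  by_cases h : rowAmp (uniformWeight p.M) s x A = 0
  · simp [h]
  · rw [rowFactor_mul_rowAmp hM s x (rowAmp_uniform_low h), ← ENNReal.ofReal_mul (by positivity),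
      norm_mul, mul_pow, Complex.norm_real, Real.norm_eq_abs, sq_abs]

/-- Negative j are rejected by the sign, and 2^B ≤ j < 2^(B+H) by a one among the checked bits. For
0 ≤ j < 2^B the amplitude is exactly the uniform one up to the factor. Only larger j are left to the
tail bound. -/
theorem tsum_rowFactor_le {n N : ℕ} [NeZero N] {r c : ℝ} {p : Params} (hc : 0 < c) (hr : 0 < r)
    (hM : (p.M : ℝ) = c * r) (hle : ∀ A, rowFactor r p A ^ 2 ≤ 1) (s x : Fin n → ZMod N) :
    ∑' A, ENNReal.ofReal (‖(rowFactor r p A : ℂ) * rowAmp (gaussianWeight r) s x A‖ ^ 2) ≤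
      ENNReal.ofReal (successFactor r p.M ^ 2) +
        ENNReal.ofReal (1 / (2 * Real.pi * c ^ 2 * 2 ^ (p.κ + p.ℓ))) := by
  have hM1 : 1 ≤ p.M := by
    have : (0 : ℝ) < p.M := by rw [hM]; positivity
    exact_mod_cast this
  set B := Nat.clog 2 p.M with hB
  set H := B + (p.κ + p.ℓ) with hH
  -- This is why H contains B besides κ + ℓ: 2^(B+H) = (2^B)² 2^(κ+ℓ), and (2^B)² ≥ (cr)² cancels
  -- the r² of the Gaussian.
  have htail := gaussian_tail_le (x := 2 * Real.pi * c ^ 2 * 2 ^ (p.κ + p.ℓ)) hr (by positivity)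
    (2 ^ (B + H)) (Nat.one_le_two_pow) (by
      have h1 : (p.M : ℝ) ≤ 2 ^ B := by exact_mod_cast Nat.le_pow_clog one_lt_two p.M
      have h2 : (c * r) ^ 2 ≤ (2 ^ B) ^ 2 := by rw [← hM]; gcongr
      have h3 : ((2 ^ (B + H) : ℕ) : ℝ) = (2 ^ B) ^ 2 * 2 ^ (p.κ + p.ℓ) := by
        push_cast; rw [hH]; ring
      rw [h3]
      calc 2 * Real.pi * c ^ 2 * 2 ^ (p.κ + p.ℓ) =
            2 * Real.pi / r ^ 2 * ((c * r) ^ 2 * 2 ^ (p.κ + p.ℓ)) := by field_simp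
        _ ≤ _ := by gcongr)
  refine le_trans ?_ (add_le_add_right htail _)
  rw [← mul_one (ENNReal.ofReal (successFactor r p.M ^ 2)), ← tsum_rowAmp_uniform hM1 s x,
    tsum_rowAmp _ _ _ (fun A z => ENNReal.ofReal (‖(rowFactor r p A : ℂ) * z‖ ^ 2)) (by simp),
    tsum_rowAmp _ _ _ (fun _ z => ENNReal.ofReal (‖z‖ ^ 2)) (by simp), ← ENNReal.tsum_mul_left,
    ← ENNReal.tsum_add]
  refine ENNReal.tsum_le_tsum fun j => ?_
  set E := rowEnc j fun a => x a + (j : ZMod N) * s a with hE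
  rcases lt_or_ge j 0 with h0 | h0
  · have : rowFactor r p E = 0 := by
      rw [rowFactor, if_pos (zero_mem_rowEnc.2 ⟨rfl, h0⟩), zero_mul]
    simp [this]
  rcases lt_or_ge j.natAbs (2 ^ B) with hj | hj
  · refine le_trans (le_of_eq ?_) le_self_add
    have key : (rowFactor r p E : ℂ) * amplitude (gaussianWeight r) j =
        successFactor r p.M * amplitude (uniformWeight p.M) j := by
      by_cases hjM : j < p.M
      · have := rowFactor_mul_rowAmp (r := r) hM1 s x (A := E)
          (rowEnc_subset_lowSet h0 (by omega) _)
        rwa [hE, rowAmp_rowEnc, rowAmp_rowEnc] at this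
      · rw [rowFactor_of_lt hM1 h0 hj, if_neg hjM, amplitude, amplitude, uniformWeight,
          if_neg (by omega)]
        simp
    rw [key, ← ENNReal.ofReal_mul (by positivity), norm_mul, mul_pow, Complex.norm_real,
      Real.norm_eq_abs, sq_abs]
  rcases lt_or_ge j.natAbs (2 ^ (B + H)) with hj' | hj'
  · have : rowFactor r p E = 0 := by
      have hne : j.natAbs / 2 ^ B ≠ 0 := by
        rw [Nat.div_ne_zero_iff]; exact ⟨by positivity, hj⟩
      obtain ⟨i, hi⟩ := Nat.exists_testBit_of_ne_zero hne
      rw [Nat.testBit_div_two_pow] at hi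
      have h1 := (Nat.ge_two_pow_of_testBit hi).trans_lt hj'
      rw [Nat.pow_lt_pow_iff_right one_lt_two] at h1
      rw [rowFactor, Finset.prod_eq_zero (i := i) (by rw [Finset.mem_range]; omega)]
      · simp
      · rw [if_pos]; rw [one_mem_rowEnc, add_comm]; exact hi
    simp [this]
  · refine le_trans ?_ le_add_self
    rw [if_pos (by omega)]
    apply ENNReal.ofReal_le_ofReal
    rw [norm_mul, mul_pow, Complex.norm_real, Real.norm_eq_abs, sq_abs]
    exact mul_le_of_le_one_left (by positivity) (hle E)

/-- Lower bound for the probability of success in one row. -/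
def successBound (c : ℝ) : ℝ :=
  Real.exp (-(8 * Real.pi * c ^ 2)) /
    (2 * (Real.exp (2 * Real.pi) * (1 + 1 / (4 * Real.pi * c))))

theorem successBound_pos {c : ℝ} (hc : 0 < c) : 0 < successBound c := by
  unfold successBound; positivity

/-- Since 2^B ≤ 2M = 2cr, the squared damping constant is at least exp(-8πc²). Since M ≥ 1 and r =
M/c, the Gaussian norm bound is a constant times M, which cancels the M in the numerator. -/
theorem successBound_mul_le {c r : ℝ} {M : ℕ} (hc : 0 < c) (hr : 0 < r) (hM : (M : ℝ) = c * r) :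
    successBound c ≤ successFactor r M ^ 2 := by
  have hM1 : 1 ≤ M := by
    have : (0 : ℝ) < M := by rw [hM]; positivity
    exact_mod_cast this
  obtain ⟨_, hZ1, hZ2⟩ := gaussianSum_spec hr
  have hM1' : (1 : ℝ) ≤ M := by exact_mod_cast hM1
  have hB : (2 : ℝ) ^ Nat.clog 2 M ≤ 2 * M := by
    rcases hM1.eq_or_lt with h | h
    · rw [← h]; simp
    · have h1 := Nat.pow_pred_clog_lt_self one_lt_two h
      have h2 : 2 ^ Nat.clog 2 M ≤ 2 * M := by
        have h3 : Nat.clog 2 M = (Nat.clog 2 M).pred + 1 := by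
          have := Nat.clog_pos one_lt_two h
          rw [Nat.pred_eq_sub_one]; omega
        rw [h3, pow_succ]; omega
      exact_mod_cast h2
  have hB1 : (1 : ℝ) ≤ 2 ^ Nat.clog 2 M := one_le_pow₀ (by norm_num)
  have e : successFactor r M ^ 2 =
      Real.exp (-(2 * Real.pi / r ^ 2) * (2 ^ Nat.clog 2 M - 1) ^ 2) * M / gaussianSum r := by
    rw [successFactor, div_pow, mul_pow, Real.sq_sqrt (by positivity), Real.sq_sqrt (by linarith),
      ← Real.exp_nat_mul]
    congr 3; push_cast; ring
  have h1 : Real.exp (-(8 * Real.pi * c ^ 2)) ≤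
      Real.exp (-(2 * Real.pi / r ^ 2) * (2 ^ Nat.clog 2 M - 1) ^ 2) := by
    rw [Real.exp_le_exp]
    have : ((2 : ℝ) ^ Nat.clog 2 M - 1) ^ 2 ≤ (2 * (c * r)) ^ 2 := by
      rw [← hM]; exact pow_le_pow_left₀ (by linarith) (by linarith) 2
    have h2 : 2 * Real.pi / r ^ 2 * (2 ^ Nat.clog 2 M - 1) ^ 2 ≤
        2 * Real.pi / r ^ 2 * (2 * (c * r)) ^ 2 := by gcongr
    have h3 : 2 * Real.pi / r ^ 2 * (2 * (c * r)) ^ 2 = 8 * Real.pi * c ^ 2 := by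
      field_simp; ring
    linarith
  have h2 : gaussianSum r ≤ 2 * (Real.exp (2 * Real.pi) * (1 + 1 / (4 * Real.pi * c))) * M := by
    refine hZ2.trans ?_
    have : 1 + r / (4 * Real.pi) ≤ (1 + 1 / (4 * Real.pi * c)) * M := by
      have h3 : 1 / (4 * Real.pi * c) * M = r / (4 * Real.pi) := by
        rw [hM]; field_simp
      linarith
    calc _ ≤ 2 * (Real.exp (2 * Real.pi) * ((1 + 1 / (4 * Real.pi * c)) * M)) := by gcongr
      _ = _ := by ring
  rw [e, successBound, div_le_div_iff₀ (by positivity) (by linarith)]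
  calc _ ≤ Real.exp (-(2 * Real.pi / r ^ 2) * (2 ^ Nat.clog 2 M - 1) ^ 2) *
        (2 * (Real.exp (2 * Real.pi) * (1 + 1 / (4 * Real.pi * c))) * M) := by gcongr
    _ = _ := by ring

/-! ### Number of successful rows -/

/-- The probability that at least `ℓ'` rows are successful, when `c` rows are successful so far and
the remaining `m` rows are successful with probability `q` and fail with probability `g`. -/
def winProb (ℓ' : ℕ) (q g : ℝ) : ℕ → ℕ → ℝ
  | 0, c => if ℓ' ≤ c then 1 else 0
  | m + 1, c => q * winProb ℓ' q g m (c + 1) + g * winProb ℓ' q g m c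

theorem winProb_nonneg {ℓ' : ℕ} {q g : ℝ} (hq : 0 ≤ q) (hg : 0 ≤ g) (m c : ℕ) :
    0 ≤ winProb ℓ' q g m c := by
  induction m generalizing c with
  | zero => rw [winProb]; split_ifs <;> norm_num
  | succ m ih => exact add_nonneg (mul_nonneg hq (ih _)) (mul_nonneg hg (ih _))

theorem winProb_zero (q g : ℝ) (m c : ℕ) : winProb 0 q g m c = (q + g) ^ m := by
  induction m generalizing c with
  | zero => simp [winProb]
  | succ m ih => rw [winProb, ih, ih]; ring

/-- Chernoff bound: (1 - t)^m is the total weight, and a final count below ℓ' is charged 2^(ℓ' -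
count) ≥ 1. One trial multiplies this charge by q/2 + (1 - q - t) ≤ 1 - q/2 on average. -/
theorem le_winProb {ℓ' : ℕ} {q t : ℝ} (hq : 0 ≤ q) (ht : 0 ≤ t) (hqt : q + t ≤ 1) (m c : ℕ) :
    (1 - t) ^ m - 2 ^ ℓ' / 2 ^ c * (1 - q / 2) ^ m ≤ winProb ℓ' q (1 - q - t) m c := by
  induction m generalizing c with
  | zero =>
    rw [winProb, pow_zero, pow_zero, mul_one]
    split_ifs with h
    · have : (0 : ℝ) ≤ 2 ^ ℓ' / 2 ^ c := by positivity
      linarith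
    · have : (1 : ℝ) ≤ 2 ^ ℓ' / 2 ^ c := by
        rw [one_le_div (by positivity)]
        exact pow_le_pow_right₀ (by norm_num) (by omega)
      linarith
  | succ m ih =>
    have h1 := mul_le_mul_of_nonneg_left (ih (c + 1)) hq
    have h2 := mul_le_mul_of_nonneg_left (ih c) (show 0 ≤ 1 - q - t by linarith)
    have h3 : 0 ≤ t * (2 ^ ℓ' / 2 ^ c * (1 - q / 2) ^ m) :=
      mul_nonneg ht (mul_nonneg (by positivity) (pow_nonneg (by linarith) m))
    have e : (2 : ℝ) ^ ℓ' / 2 ^ (c + 1) = 2 ^ ℓ' / 2 ^ c / 2 := by rw [pow_succ]; field_simp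
    rw [winProb]
    rw [e] at h1
    simp only [pow_succ]
    nlinarith

/-! ### Analysis of the reduction -/

theorem wp_body {r : ℝ} {p : Params} {cnt k : ℕ} {φ : Memory}
    (hφ : Clean k φ) {ds : List (Row → ℝ)}
    (hds : ∀ φ, Clean k φ → ∀ Q, ∀ ok ≤ 1, rowProg.wp r Q (st p cnt k ok 0 0 0 0 0 0 0) φ =
      Q (st p cnt k ok 0 0 0 0 0 0 0) (scale k (rowFactor r p) φ) +
        (ds.map fun d => Q (st p cnt k 0 0 0 0 0 0 0 0) (scale k d φ)).sum)
    (Q : (ℕ → ℕ) → Memory → ℝ≥0∞) :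
    ((.assign 8 (.lit 1) ;; rowProg ;;
      .ite (.lit 1) (.var 8) (moveProg ;; .assign 6 (.add (.var 6) (.lit 1))) .skip ;;
      .assign 8 (.lit 0)) ;; .assign 7 (.lit 0) : Program).wp r Q
        (Function.update (st p cnt 0 0 0 0 0 0 0 0 0) 7 k) φ =
      Q (st p (cnt + 1) 0 0 0 0 0 0 0 0 0)
        (permute (rowSwap (lowSet p.n p.N p.M) k cnt) (scale k (rowFactor r p) φ)) +
      (ds.map fun d => Q (st p cnt 0 0 0 0 0 0 0 0 0) (scale k d φ)).sum := by
  simp only [Program.wp, update_st_seven, update_st_eight, NExpr.eval]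
  rw [hds φ hφ _ 1 le_rfl]
  simp [moveProg_wp]

theorem rowProg_weakSpec (r : ℝ) (p : Params) (cnt k : ℕ) :
    WeakSpec r k rowProg (fun ok => st p cnt k ok 0 0 0 0 0 0 0)
      (fun ok => st p cnt k ok 0 0 0 0 0 0 0) (rowFactor r p) :=
  rowProg_spec r p cnt k

/-- The completeness relation of the measurement: the squares of all branches add up to 1. -/
theorem rowFactor_sq_le_one (r : ℝ) (p : Params) (A : Row) : rowFactor r p A ^ 2 ≤ 1 := by
  obtain ⟨ds, hds, _⟩ := rowProg_weakSpec r p 0 0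
  rw [← hds A]
  exact le_add_of_nonneg_right (List.sum_nonneg (by simp; intros; positivity))

/-- The weights of the failing branches add up to the probability of failure. -/
theorem le_sum_fail {G : Row → ℂ} {m : Row → ℝ} {ds : List (Row → ℝ)} {q t : ℝ} (hq : 0 ≤ q)
    (ht : 0 ≤ t) (hds : ∀ A, m A ^ 2 + (ds.map fun d => d A ^ 2).sum = 1)
    (hG : ∑' A, ENNReal.ofReal (‖G A‖ ^ 2) = 1)
    (hm : ∑' A, ENNReal.ofReal (‖(m A : ℂ) * G A‖ ^ 2) ≤ ENNReal.ofReal q + ENNReal.ofReal t) :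
    ENNReal.ofReal (1 - q - t) ≤
      (ds.map fun d => ∑' A, ENNReal.ofReal (‖(d A : ℂ) * G A‖ ^ 2)).sum := by
  have key : ∀ (L : List (Row → ℝ)),
      (L.map fun d => ∑' A, ENNReal.ofReal (‖(d A : ℂ) * G A‖ ^ 2)).sum =
        ∑' A, ENNReal.ofReal ((L.map fun d => d A ^ 2).sum * ‖G A‖ ^ 2) := by
    intro L
    induction L with
    | nil => simp
    | cons d L ih =>
      rw [List.map_cons, List.sum_cons, ih, ← ENNReal.tsum_add]
      refine tsum_congr fun A => ?_
      have h0 : 0 ≤ (L.map fun d => d A ^ 2).sum :=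
        List.sum_nonneg (by simp; intros; positivity)
      rw [← ENNReal.ofReal_add (by positivity) (by positivity), List.map_cons, List.sum_cons,
        norm_mul, mul_pow, Complex.norm_real, Real.norm_eq_abs, sq_abs, add_mul]
  have total : ∑' A, ENNReal.ofReal (‖(m A : ℂ) * G A‖ ^ 2) +
      (ds.map fun d => ∑' A, ENNReal.ofReal (‖(d A : ℂ) * G A‖ ^ 2)).sum = 1 := by
    have h1 := key (m :: ds)
    simp only [List.map_cons, List.sum_cons, hds, one_mul, hG] at h1
    exact h1
  rw [← ENNReal.ofReal_add hq ht] at hm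
  rw [sub_sub, ENNReal.ofReal_sub _ (by positivity), ENNReal.ofReal_one, tsub_le_iff_left, ← total]
  exact add_le_add_left hm _

theorem prod_filter_lt_succ {ℓ : ℕ} (w : Fin ℓ → ℝ≥0∞) (k : Fin ℓ) (v : ℝ≥0∞) :
    ∏ j ∈ Finset.univ.filter (fun j : Fin ℓ => (j : ℕ) < k + 1), Function.update w k v j =
      (∏ j ∈ Finset.univ.filter (fun j : Fin ℓ => (j : ℕ) < k), w j) * v := by
  have h : (Finset.univ.filter fun j : Fin ℓ => (j : ℕ) < k + 1) =
      insert k (Finset.univ.filter fun j : Fin ℓ => (j : ℕ) < k) := by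
    ext j
    simp only [Finset.mem_filter, Finset.mem_univ, true_and, Finset.mem_insert, Fin.ext_iff]
    omega
  rw [h, Finset.prod_insert (by simp), Function.update_self, mul_comm]
  congr 1
  refine Finset.prod_congr rfl fun j hj => ?_
  rw [Function.update_of_ne]
  rintro rfl
  simp at hj

/-- The state in which the rows below `k` have been measured, `cnt` of them successfully: those are
the rows `κs t`, which have been moved to the rows `t`. The numbers `w j` are lower bounds for the
weights of the measured rows. -/
structure Stage {n N ℓ : ℕ} (r : ℝ) (M : ℕ) (s : Fin n → ZMod N) (x : Fin ℓ → Fin n → ZMod N)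
    (k cnt : ℕ) (f : Fin ℓ → Row → ℂ) (τ : Equiv.Perm Qubit) (κs : ℕ → ℕ)
    (w : Fin ℓ → ℝ≥0∞) : Prop where
  cnt_le : cnt ≤ k
  κs_lt : ∀ t < cnt, κs t < k
  κs_inj : ∀ t < cnt, ∀ t' < cnt, κs t = κs t' → t = t'
  τ_fix : ∀ a k' i, k ≤ k' → τ (a, k', i) = (a, k', i)
  τ_low : ∀ t < cnt, ∀ a i, (a, i) ∈ lowSet n N M → τ (a, t, i) = (a, κs t, i)
  f_fresh : ∀ j : Fin ℓ, k ≤ j → f j = rowAmp (gaussianWeight r) s (x j)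
  f_success : ∀ t < cnt, ∀ j : Fin ℓ, (j : ℕ) = κs t → ∀ A : Row, (∀ v ∈ A, v ∈ lowSet n N M) →
    f j A = successFactor r M * rowAmp (uniformWeight M) s (x j) A
  w_le : ∀ j : Fin ℓ, (j : ℕ) < k → w j ≤ ∑' A, ENNReal.ofReal (‖f j A‖ ^ 2)
  w_success : ∀ t < cnt, ∀ j : Fin ℓ, (j : ℕ) = κs t →
    w j ≤ ENNReal.ofReal (successFactor r M ^ 2)

section Stage
variable {n N ℓ : ℕ} {r : ℝ} {M : ℕ} {s : Fin n → ZMod N} {x : Fin ℓ → Fin n → ZMod N}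
  {cnt : ℕ} {f : Fin ℓ → Row → ℂ} {τ : Equiv.Perm Qubit} {κs : ℕ → ℕ} {w : Fin ℓ → ℝ≥0∞}

/-- A rejected row stays where it is and contributes its full weight, whatever its state. -/
theorem Stage.fail {k : Fin ℓ} (h : Stage r M s x k cnt f τ κs w) (d : Row → ℝ) :
    Stage r M s x (k + 1) cnt (Function.update f k fun A => (d A : ℂ) * f k A) τ κs
      (Function.update w k (∑' A, ENNReal.ofReal (‖(d A : ℂ) * f k A‖ ^ 2))) where
  cnt_le := h.cnt_le.trans (Nat.le_succ _)
  κs_lt t ht := (h.κs_lt t ht).trans (Nat.lt_succ_self _)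
  κs_inj := h.κs_inj
  τ_fix a k' i hk := h.τ_fix a k' i (by omega)
  τ_low := h.τ_low
  f_fresh j hj := by
    rw [Function.update_of_ne (by rintro rfl; omega), h.f_fresh j (by omega)]
  f_success t ht j hj A hA := by
    have := h.κs_lt t ht
    rw [Function.update_of_ne (by rintro rfl; omega), h.f_success t ht j hj A hA]
  w_le j hj := by
    by_cases hjk : j = k
    · subst hjk; simp only [Function.update_self, le_refl]
    · have : (j : ℕ) ≠ k := fun h' => hjk (Fin.ext h')
      rw [Function.update_of_ne hjk, Function.update_of_ne hjk]
      exact h.w_le j (by omega)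
  w_success t ht j hj := by
    have := h.κs_lt t ht
    rw [Function.update_of_ne (by rintro rfl; omega)]
    exact h.w_success t ht j hj

/-- An accepted row is credited only with the weight of its uniform part. The exchange touches only
rows up to `k`, so later rows remain fresh. -/
theorem Stage.success {k : Fin ℓ} (h : Stage r M s x k cnt f τ κs w) (d : Row → ℝ)
    (hd : ∀ A : Row, (∀ v ∈ A, v ∈ lowSet n N M) →
      (d A : ℂ) * f k A = successFactor r M * rowAmp (uniformWeight M) s (x k) A)
    (hq : ENNReal.ofReal (successFactor r M ^ 2) ≤
      ∑' A, ENNReal.ofReal (‖(d A : ℂ) * f k A‖ ^ 2)) :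
    Stage r M s x (k + 1) (cnt + 1) (Function.update f k fun A => (d A : ℂ) * f k A)
      (τ * rowSwap (lowSet n N M) k cnt) (Function.update κs cnt k)
      (Function.update w k (ENNReal.ofReal (successFactor r M ^ 2))) := by
  have hκ : ∀ t < cnt, Function.update κs cnt k t = κs t := fun t ht =>
    Function.update_of_ne ht.ne _ _
  have hcnt := h.cnt_le
  refine ⟨by omega, ?_, ?_, ?_, ?_, ?_, ?_, ?_, ?_⟩
  · intro t ht
    rcases Nat.lt_succ_iff_lt_or_eq.1 ht with ht | rfl
    · rw [hκ t ht]; exact (h.κs_lt t ht).trans (Nat.lt_succ_self _)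
    · rw [Function.update_self]; exact Nat.lt_succ_self _
  · intro t ht t' ht' he
    rcases Nat.lt_succ_iff_lt_or_eq.1 ht with ht | rfl <;>
      rcases Nat.lt_succ_iff_lt_or_eq.1 ht' with ht' | rfl
    · rw [hκ t ht, hκ t' ht'] at he; exact h.κs_inj t ht t' ht' he
    · rw [hκ t ht, Function.update_self] at he
      have := h.κs_lt t ht; omega
    · rw [hκ t' ht', Function.update_self] at he
      have := h.κs_lt t' ht'; omega
    · rfl
  · intro a k' i hk
    rw [Equiv.Perm.mul_apply]
    have : rowSwap (lowSet n N M) k cnt (a, k', i) = (a, k', i) := by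
      by_cases hU : (a, i) ∈ lowSet n N M
      · rw [rowSwap_of_mem hU, Equiv.swap_apply_of_ne_of_ne (by omega) (by omega)]
      · exact rowSwap_of_notMem hU
    rw [this, h.τ_fix a k' i (by omega)]
  · intro t ht a i hai
    rw [Equiv.Perm.mul_apply, rowSwap_of_mem hai]
    rcases Nat.lt_succ_iff_lt_or_eq.1 ht with ht | rfl
    · rw [Equiv.swap_apply_of_ne_of_ne (by omega) (by omega), hκ t ht, h.τ_low t ht a i hai]
    · rw [Equiv.swap_apply_right, Function.update_self, h.τ_fix a k i le_rfl]
  · intro j hj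
    rw [Function.update_of_ne (by rintro rfl; omega), h.f_fresh j (by omega)]
  · intro t ht j hj A hA
    rcases Nat.lt_succ_iff_lt_or_eq.1 ht with ht | rfl
    · rw [hκ t ht] at hj
      have := h.κs_lt t ht
      rw [Function.update_of_ne (by rintro rfl; omega), h.f_success t ht j hj A hA]
    · rw [Function.update_self] at hj
      obtain rfl : j = k := Fin.ext hj
      rw [Function.update_self, hd A hA]
  · intro j hj
    by_cases hjk : j = k
    · subst hjk; simpa only [Function.update_self] using hq
    · have : (j : ℕ) ≠ k := fun h' => hjk (Fin.ext h')
      rw [Function.update_of_ne hjk, Function.update_of_ne hjk]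
      exact h.w_le j (by omega)
  · intro t ht j hj
    rcases Nat.lt_succ_iff_lt_or_eq.1 ht with ht | rfl
    · rw [hκ t ht] at hj
      have := h.κs_lt t ht
      rw [Function.update_of_ne (by rintro rfl; omega)]
      exact h.w_success t ht j hj
    · rw [Function.update_self] at hj
      obtain rfl : j = k := Fin.ext hj
      rw [Function.update_self]

/-- The solver reads the first ℓ' accepted rows; surplus accepted rows count, like the rejected
ones, only through their weights. -/
theorem Stage.le_prob [NeZero N] {ℓ' : ℕ} (h : Stage r M s x ℓ cnt f τ κs w) (hcnt : ℓ' ≤ cnt)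
    (O : Solver n N M ℓ') {a : ℝ≥0∞} (ha : ∀ x : Fin ℓ' → Fin n → ZMod N, a ≤ O.prob s (edcpState (uniformWeight M) s x)) :
    a * ∏ j, w j ≤ O.prob s (permute τ (prodState f)) := by
  classical
  let κ' : Fin ℓ' → Fin ℓ := fun t => ⟨κs t, h.κs_lt t (t.2.trans_le hcnt)⟩
  have hκ' : Function.Injective κ' := fun t t' he =>
    Fin.ext (h.κs_inj t (t.2.trans_le hcnt) t' (t'.2.trans_le hcnt) (congrArg Fin.val he))
  refine le_trans ?_ (O.le_prob_permute s x f τ κ' hκ' (successFactor r M) ?_ ?_)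
  · rw [mul_comm]
    refine mul_le_mul' ?_ (ha _)
    rw [← Fintype.prod_subtype_mul_prod_subtype (fun k => k ∈ Set.range κ')]
    refine mul_le_mul' ?_ (Finset.prod_le_prod' fun k _ => h.w_le k k.1.2)
    rw [← Fin.prod_const]
    refine (prod_subtype_range hκ' w).trans_le ?_
    exact Finset.prod_le_prod' fun t _ => h.w_success t (t.2.trans_le hcnt) _ rfl
  · intro v
    have := h.τ_low v.1 (v.1.2.trans_le hcnt) _ _ v.address_mem_lowSet
    rw [← this, ← v.address_row]
  · intro t A hA
    exact h.f_success t (t.2.trans_le hcnt) _ rfl A hA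

end Stage

/-- The payoff of the reduction in terms of the probability of enough successful rows. -/
theorem le_wp_reduction {p : Params} [NeZero p.N] {r c : ℝ} (hc : 0 < c) (hr : 0 < r)
    (hM : (p.M : ℝ) = c * r) (s : Fin p.n → ZMod p.N) (x : Fin p.ℓ → Fin p.n → ZMod p.N)
    (O : Solver p.n p.N p.M p.ℓ') {a : ℝ≥0∞}
    (ha : ∀ x : Fin p.ℓ' → Fin p.n → ZMod p.N, a ≤ O.prob s (edcpState (uniformWeight p.M) s x)) {t : ℝ}
    (hqt : successFactor r p.M ^ 2 + t ≤ 1)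
    (hle : ENNReal.ofReal (1 - successFactor r p.M ^ 2 - t) ≤
      ENNReal.ofReal (1 - successFactor r p.M ^ 2 - 1 / (2 * Real.pi * c ^ 2 * 2 ^ (p.κ + p.ℓ)))) :
    a * ENNReal.ofReal
        (winProb p.ℓ' (successFactor r p.M ^ 2) (1 - successFactor r p.M ^ 2 - t) p.ℓ 0) ≤
      reduction.wp r (fun _ ψ => O.prob s ψ) (st p 0 0 0 0 0 0 0 0 0 0)
        (edcpState (gaussianWeight r) s x) := by
  have hM1 : 1 ≤ p.M := by
    have : (0 : ℝ) < p.M := by rw [hM]; positivity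
    exact_mod_cast this
  set q := successFactor r p.M ^ 2 with hq
  have hq0 : 0 ≤ q := sq_nonneg _
  have hg0 : 0 ≤ 1 - q - t := by linarith
  set body : Program := (.assign 8 (.lit 1) ;; rowProg ;;
      .ite (.lit 1) (.var 8) (moveProg ;; .assign 6 (.add (.var 6) (.lit 1))) .skip ;;
      .assign 8 (.lit 0)) ;; .assign 7 (.lit 0) with hbody
  -- Induction on the number `m` of rows still to be measured: the two summands of `winProb`
  -- correspond to the accepting branch and to all failing branches together.
  have key : ∀ m k, k + m = p.ℓ → ∀ cnt f τ κs w, Stage r p.M s x k cnt f τ κs w →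
      a * (∏ j ∈ Finset.univ.filter (fun j : Fin p.ℓ => (j : ℕ) < k), w j) * ENNReal.ofReal (winProb p.ℓ' q (1 - q - t) m cnt) ≤
      (List.range' k m).foldr (fun i K σ ψ => body.wp r K (Function.update σ 7 i) ψ)
        (fun _ ψ => O.prob s ψ) (st p cnt 0 0 0 0 0 0 0 0 0) (permute τ (prodState f)) := by
    intro m
    induction m with
    | zero =>
      intro k hk cnt f τ κs w h
      obtain rfl : k = p.ℓ := by omega
      rw [winProb, List.range'_zero, List.foldr_nil]
      split_ifs with hcnt
      · have : (Finset.univ.filter fun j : Fin p.ℓ => (j : ℕ) < p.ℓ) = Finset.univ := by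
          ext j; simp
        rw [this, ENNReal.ofReal_one, mul_one]
        exact h.le_prob hcnt O ha
      · simp
    | succ m ih =>
      intro k hk cnt f τ κs w h
      obtain ⟨k, rfl⟩ : ∃ k' : Fin p.ℓ, (k' : ℕ) = k := ⟨⟨k, by omega⟩, rfl⟩
      have hfk := h.f_fresh k le_rfl
      have hfix : ∀ a i, τ (a, (k : ℕ), i) = (a, (k : ℕ), i) := fun a i => h.τ_fix a k i le_rfl
      have hclean : Clean k (permute τ (prodState f)) := by
        refine clean_permute_prodState hfix fun A hA i hi => ?_
        rw [hfk] at hA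
        obtain ⟨j, rfl⟩ := exists_of_rowAmp_ne_zero hA
        rw [zero_mem_rowEnc]; omega
      obtain ⟨ds, hds, hspec⟩ := rowProg_weakSpec r p cnt k
      rw [List.range'_succ, List.foldr_cons, hbody, wp_body hclean hspec]
      simp only [scale_permute hfix, scale_prodState, permute_permute]
      have hsucc := ih (k + 1) (by omega) (cnt + 1) _ _ _ _ (h.success (rowFactor r p)
        (fun A hA => by rw [hfk]; exact rowFactor_mul_rowAmp hM1 s (x k) hA)
        (by rw [hfk]; exact successFactor_sq_le_tsum hM1 s (x k)))
      rw [prod_filter_lt_succ, ← hq] at hsucc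
      have hfail : ∀ d : Row → ℝ, _ := fun d => ih (k + 1) (by omega) cnt _ _ _ _ (h.fail d)
      simp only [prod_filter_lt_succ] at hfail
      set W := ∏ j ∈ Finset.univ.filter (fun j : Fin p.ℓ => (j : ℕ) < k), w j
      set F := (List.range' (k + 1) m).foldr
        (fun i K σ ψ => body.wp r K (Function.update σ 7 i) ψ) (fun _ ψ => O.prob s ψ) with hF
      have hW := le_sum_fail (G := f k) (t := 1 / (2 * Real.pi * c ^ 2 * 2 ^ (p.κ + p.ℓ)))
        hq0 (by positivity) hds
        (by rw [hfk]; exact tsum_rowAmp_gaussian hr s (x k))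
        (by rw [hfk]; exact tsum_rowFactor_le hc hr hM (rowFactor_sq_le_one r p) s (x k))
      -- The induction hypothesis, applied to each failing branch with its own weight, is linear in
      -- that weight, so only the sum of the weights matters.
      have hsum : ∀ L : List (Row → ℝ),
          a * W * ENNReal.ofReal (winProb p.ℓ' q (1 - q - t) m cnt) *
            (L.map fun d => ∑' A, ENNReal.ofReal (‖(d A : ℂ) * f k A‖ ^ 2)).sum ≤
          (L.map fun d => F (st p cnt 0 0 0 0 0 0 0 0 0)
            (permute τ (prodState (Function.update f k fun A => (d A : ℂ) * f k A)))).sum := by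
        intro L
        induction L with
        | nil => simp
        | cons d L ihL =>
          rw [List.map_cons, List.sum_cons, List.map_cons, List.sum_cons, mul_add]
          refine add_le_add (le_trans (le_of_eq ?_) (hfail d)) ihL
          ring
      refine le_trans ?_ (add_le_add hsucc (hsum ds))
      rw [winProb, ENNReal.ofReal_add (mul_nonneg hq0 (winProb_nonneg hq0 hg0 _ _))
        (mul_nonneg hg0 (winProb_nonneg hq0 hg0 _ _)), ENNReal.ofReal_mul hq0,
        ENNReal.ofReal_mul hg0, mul_add]
      refine add_le_add (le_of_eq (by ring)) ?_
      calc _ = a * W * ENNReal.ofReal (winProb p.ℓ' q (1 - q - t) m cnt) *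
            ENNReal.ofReal (1 - q - t) := by ring
        _ ≤ _ := mul_le_mul_right (hle.trans hW) _
  have h0 : Stage r p.M s x 0 0 (fun k => rowAmp (gaussianWeight r) s (x k)) 1 id
      (fun _ => 1) :=
    ⟨le_rfl, by simp, by simp, by simp, by simp, by simp, by simp, by simp, by simp⟩
  have := key p.ℓ 0 (by omega) 0 _ _ _ _ h0
  rw [permute_one, ← edcpState_eq_prodState] at this
  simp only [not_lt_zero, Finset.filter_false, Finset.prod_empty, mul_one] at this
  refine this.trans (le_of_eq ?_)
  simp only [reduction, forLoop, Program.wp, NExpr.eval, st_three, List.range_eq_range', hbody]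

/-! ### Choice of the constants -/

/-- With e = exp(-ηκ) = 2^(-δκ), leakage costs at most Ce² and too few successes at most e². For
large κ the sum (C + 1)e² is at most e. -/
theorem exists_winProb_bound {q₀ C A : ℝ} (hq₀ : 0 < q₀) (hC : 0 < C) (hA : 0 < A) :
    ∃ (δ : ℝ) (κ₀ : ℕ), 0 < δ ∧ ∀ (κ ℓ ℓ' : ℕ) (q t : ℝ), κ₀ ≤ κ → (κ : ℝ) * ℓ' ≤ A * ℓ →
      q₀ ≤ q → 0 ≤ t → q + t ≤ 1 → t ≤ C / 2 ^ (κ + ℓ) →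
      0 ≤ 1 - (2 : ℝ) ^ (-(δ * (κ : ℝ))) ∧
      1 - (2 : ℝ) ^ (-(δ * (κ : ℝ))) ≤ winProb ℓ' q (1 - q - t) ℓ 0 := by
  have hlog : 0 < Real.log 2 := Real.log_pos (by norm_num)
  -- The first bound gives 2^(-κ) ≤ e². The second gives 2ηκ ≤ q₀ℓ/4 as soon as κ ≤ Aℓ.
  set η := min (Real.log 2 / 2) (q₀ / (8 * A)) with hη
  have hη0 : 0 < η := lt_min (by positivity) (by positivity)
  have hη1 : 2 * η ≤ Real.log 2 := by linarith [min_le_left (Real.log 2 / 2) (q₀ / (8 * A))]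
  have hη2 : 2 * η ≤ q₀ / (4 * A) := by
    have h1 := min_le_right (Real.log 2 / 2) (q₀ / (8 * A))
    have h2 : q₀ / (4 * A) = 2 * (q₀ / (8 * A)) := by field_simp; norm_num
    linarith
  -- The first summand of the threshold makes 2^ℓ' at most exp(q₀ℓ/4), half of the available
  -- exponent; the second makes (C + 1)e ≤ 1/2.
  refine ⟨η / Real.log 2, ⌈4 * A * Real.log 2 / q₀ + 2 * (C + 1) / η⌉₊ + 1, by positivity, ?_⟩
  intro κ ℓ ℓ' q t hκ hℓ hq ht hqt htC
  have hκ1 : (1 : ℝ) ≤ κ := by exact_mod_cast (Nat.le_add_left _ _).trans hκ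
  have hκ' : 4 * A * Real.log 2 / q₀ + 2 * (C + 1) / η ≤ κ :=
    (Nat.le_ceil _).trans (by exact_mod_cast (Nat.le_succ _).trans hκ)
  have hκA : 4 * A * Real.log 2 ≤ q₀ * κ := by
    have h1 : 4 * A * Real.log 2 / q₀ ≤ κ := by
      have : 0 ≤ 2 * (C + 1) / η := by positivity
      linarith
    rw [div_le_iff₀ hq₀] at h1; linarith
  have hκη : 2 * (C + 1) ≤ η * κ := by
    have h1 : 2 * (C + 1) / η ≤ κ := by
      have : 0 ≤ 4 * A * Real.log 2 / q₀ := by positivity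
      linarith
    rw [div_le_iff₀ hη0] at h1; linarith
  have hpow : (2 : ℝ) ^ (-(η / Real.log 2 * (κ : ℝ))) = Real.exp (-(η * κ)) := by
    rw [Real.rpow_def_of_pos (by norm_num)]
    congr 1; field_simp
  set e := Real.exp (-(η * κ)) with he
  have he0 : 0 < e := Real.exp_pos _
  have heC : (C + 1) * e ≤ 1 / 2 := by
    have h1 : 2 * (C + 1) ≤ Real.exp (η * κ) := by linarith [Real.add_one_le_exp (η * κ)]
    rw [he, Real.exp_neg, ← div_eq_mul_inv, div_le_iff₀ (Real.exp_pos _)]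
    linarith
  have he2 : Real.exp (-(2 * η * κ)) = e * e := by rw [he, ← Real.exp_add]; congr 1; ring
  have he1 : e ≤ 1 / 2 := by nlinarith
  rw [hpow]
  refine ⟨by linarith, ?_⟩
  -- Bernoulli's inequality; the number ℓ of trials is absorbed by the 2^ℓ in the bound for `t`.
  have hpoison : 1 - C * (e * e) ≤ (1 - t) ^ ℓ := by
    have h1 : 1 - ℓ * t ≤ (1 - t) ^ ℓ := by
      have := one_add_mul_le_pow (a := -t) (by linarith) ℓ
      rw [← sub_eq_add_neg] at this
      linarith
    have h2 : (ℓ : ℝ) * t ≤ C / 2 ^ κ := by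
      have h3 : (ℓ : ℝ) ≤ 2 ^ ℓ := by exact_mod_cast Nat.lt_two_pow_self.le
      calc (ℓ : ℝ) * t ≤ 2 ^ ℓ * (C / 2 ^ (κ + ℓ)) := by gcongr
        _ = C / 2 ^ κ := by rw [pow_add]; field_simp
    have h3 : C / 2 ^ κ ≤ C * (e * e) := by
      rw [div_eq_mul_inv, ← he2]
      refine mul_le_mul_of_nonneg_left ?_ hC.le
      rw [← Real.exp_log (show (0 : ℝ) < (2 ^ κ)⁻¹ by positivity), Real.exp_le_exp, Real.log_inv,
        Real.log_pow]
      nlinarith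
    linarith
  have hCe : C * (e * e) ≤ e / 2 := by nlinarith
  -- For ℓ' = 0 the hypothesis does not bound ℓ below in terms of κ, so (1 - q/2)^ℓ may be large;
  -- but then no success is needed at all.
  rcases Nat.eq_zero_or_pos ℓ' with rfl | hℓ'
  · rw [winProb_zero, show q + (1 - q - t) = 1 - t by ring]
    linarith
  · refine le_trans ?_ (le_winProb (by linarith) ht hqt ℓ 0)
    have hfew : (2 : ℝ) ^ ℓ' / 2 ^ 0 * (1 - q / 2) ^ ℓ ≤ e * e := by
      have h1 : (1 - q / 2) ^ ℓ ≤ Real.exp (-(ℓ * (q₀ / 2))) := by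
        calc (1 - q / 2) ^ ℓ ≤ (Real.exp (-(q₀ / 2))) ^ ℓ := by
              refine pow_le_pow_left₀ (by linarith) ?_ ℓ
              linarith [Real.add_one_le_exp (-(q₀ / 2))]
          _ = _ := by rw [← Real.exp_nat_mul]; congr 1; ring
      have h2 : (2 : ℝ) ^ ℓ' = Real.exp (ℓ' * Real.log 2) := by
        rw [Real.exp_nat_mul, Real.exp_log (by norm_num)]
      have hℓ1 : (1 : ℝ) ≤ ℓ' := by exact_mod_cast hℓ'
      have h3 : (ℓ' : ℝ) * Real.log 2 ≤ ℓ * (q₀ / 4) := by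
        have h4 : (ℓ' : ℝ) * (4 * A * Real.log 2) ≤ A * (q₀ * ℓ) :=
          calc (ℓ' : ℝ) * (4 * A * Real.log 2) ≤ ℓ' * (q₀ * κ) := by gcongr
            _ = q₀ * (κ * ℓ') := by ring
            _ ≤ q₀ * (A * ℓ) := by gcongr
            _ = _ := by ring
        have h5 : A * (ℓ' * (4 * Real.log 2)) ≤ A * (q₀ * ℓ) := by linarith
        have := le_of_mul_le_mul_left h5 hA
        linarith
      have h4 : 2 * η * κ ≤ ℓ * (q₀ / 4) := by
        have h5 : (κ : ℝ) ≤ A * ℓ := by nlinarith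
        calc 2 * η * κ ≤ q₀ / (4 * A) * (A * ℓ) := by gcongr
          _ = _ := by field_simp
      rw [pow_zero, div_one, h2, ← he2]
      calc _ ≤ Real.exp (ℓ' * Real.log 2) * Real.exp (-(ℓ * (q₀ / 2))) := by gcongr
        _ = Real.exp (ℓ' * Real.log 2 + -(ℓ * (q₀ / 2))) := (Real.exp_add _ _).symm
        _ ≤ _ := by rw [Real.exp_le_exp]; linarith
    nlinarith

theorem st_eq_getD (p : Params) : (fun i => [p.κ, p.n, p.N, p.ℓ, p.ℓ', p.M].getD i 0) =
    st p 0 0 0 0 0 0 0 0 0 0 := by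
  funext i
  rcases lt_or_ge i 16 with h | h
  · interval_cases i <;> rfl
  · rw [st, List.getD_eq_default _ _ (by simp; omega), List.getD_eq_default _ _ (by simpa using h)]

/-- The factor's square is at most the weight of an accepting branch, hence at most the total weight
1. Any instance shows this; the smallest one is taken. -/
theorem successFactor_sq_le_one {r c : ℝ} {M : ℕ} (hc : 0 < c) (hr : 0 < r)
    (hM : (M : ℝ) = c * r) : successFactor r M ^ 2 ≤ 1 := by
  have hM1 : 1 ≤ M := by
    have : (0 : ℝ) < M := by rw [hM]; positivity
    exact_mod_cast this
  have h := successFactor_sq_le_tsum (n := 1) (N := 1) (r := r) (p := ⟨0, 0, 0, 0, 0, M⟩) hM1 0 0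
  have h2 := tsum_rowAmp_gaussian (n := 1) (N := 1) hr 0 0
  rw [← ENNReal.ofReal_le_one, ← h2]
  refine h.trans (ENNReal.tsum_le_tsum fun A => ENNReal.ofReal_le_ofReal ?_)
  rw [norm_mul, mul_pow, Complex.norm_real, Real.norm_eq_abs, sq_abs]
  exact mul_le_of_le_one_left (by positivity) (rowFactor_sq_le_one _ _ A)

end EDCP

end

/-! ### Assembly of running time and correctness -/

theorem mainTheorem7 (c : ℝ) (hc : 0 < c) :
    ∃ (P : EDCP.Program) (T : Polynomial ℕ),
      (∀ (κ n N ℓ ℓ' M : ℕ) (r : ℝ), 1 < n → 1 < N → 1 < ℓ → 0 < r → (M : ℝ) = c * r →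
        ∀ (s : Fin n → ZMod N) (x : Fin ℓ → Fin n → ZMod N),
          ∀ C ∈ P.branches κ n N ℓ ℓ' M r s x,
            C.steps ≤ T.eval (κ + n + Nat.clog 2 N + ℓ + Nat.clog 2 M)) ∧
      ∀ A : ℝ, 0 < A → ∃ (δ : ℝ) (κ₀ : ℕ), 0 < δ ∧
        ∀ (κ n N ℓ ℓ' M : ℕ) (r : ℝ), κ₀ ≤ κ → 1 < n → 1 < N → 1 < ℓ → 0 < r → (M : ℝ) = c * r →
          (κ : ℝ) * ℓ' ≤ A * ℓ →
          ∀ (O : EDCP.Solver n N M ℓ') (s : Fin n → ZMod N) (p : ℝ),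
            O.FindsUniform s p →
            P.FindsGaussian κ ℓ r O s (p * (1 - (2 : ℝ) ^ (-(δ * (κ : ℝ))))) := by
  refine ⟨EDCP.reduction, EDCP.reduction.cost.comp (2 * Polynomial.X), ?_, ?_⟩
  · intro κ n N ℓ ℓ' M r _ _ _ _ _ s x C hC
    refine ((EDCP.reduction_bounded κ n N ℓ ℓ' M).steps_le r _ (fun _ _ => rfl) C hC).2.trans ?_
    simp
  · intro A hA
    obtain ⟨δ, κ₀, hδ, h⟩ := EDCP.exists_winProb_bound (EDCP.successBound_pos hc)
      (show 0 < 1 / (2 * Real.pi * c ^ 2) by positivity) hA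
    refine ⟨δ, κ₀, hδ, ?_⟩
    intro κ n N ℓ ℓ' M r hκ _ hN _ hr hM hℓ O s p hO x
    have : NeZero N := ⟨by omega⟩
    set q := EDCP.successFactor r M ^ 2 with hq
    have hq1 : q ≤ 1 := EDCP.successFactor_sq_le_one hc hr hM
    set τ := 1 / (2 * Real.pi * c ^ 2 * 2 ^ (κ + ℓ)) with hτ
    -- The leakage bound τ may exceed 1 - q; truncating it keeps the failure probability 1 - q - t
    -- nonnegative, and `ENNReal.ofReal` truncates in the same way.
    have ht0 : 0 ≤ min τ (1 - q) := le_min (by positivity) (by linarith)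
    have hqt : q + min τ (1 - q) ≤ 1 := by linarith [min_le_right τ (1 - q)]
    obtain ⟨h0, h1⟩ := h κ ℓ ℓ' q (min τ (1 - q)) hκ hℓ
      (EDCP.successBound_mul_le hc hr hM) ht0 hqt
      ((min_le_left _ _).trans (le_of_eq (by rw [hτ]; field_simp)))
    have hle : ENNReal.ofReal (1 - q - min τ (1 - q)) ≤ ENNReal.ofReal (1 - q - τ) := by
      rcases le_total τ (1 - q) with h | h
      · rw [min_eq_left h]
      · rw [min_eq_right h, sub_self, ENNReal.ofReal_zero]
        exact zero_le
    have key := EDCP.le_wp_reduction (p := ⟨κ, n, N, ℓ, ℓ', M⟩) hc hr hM s x O hO hqt hle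
    rw [EDCP.Program.branches, EDCP.Program.sum_run r _ (fun _ ψ => O.prob s ψ)]
    simp only
    rw [EDCP.st_eq_getD ⟨κ, n, N, ℓ, ℓ', M⟩]
    refine le_trans ?_ key
    -- For p ≤ 0 the claimed bound is nonpositive, so its image in `ℝ≥0∞` is zero.
    rcases le_total p 0 with hp | hp
    · rw [ENNReal.ofReal_of_nonpos (mul_nonpos_of_nonpos_of_nonneg hp h0)]
      exact zero_le
    · rw [ENNReal.ofReal_mul hp]
      exact mul_le_mul_right (ENNReal.ofReal_le_ofReal h1) _
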